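/- Let $G$ be a finite connected simple graph in which every vertex has degree at least $2$. An edge path without backtracking is a sequence of oriented edges $e_1,e_2,\dots$ such that $e_{i+1}$ starts where $e_i$ ends and $e_{i+1}$ is not the opposite of $e_i$. Let $\mathfrak P$ be the space of infinite edge paths without backtracking, with the topology whose basic open sets are the sets of all paths with a given finite prefix; for a vertex $x$ let $\mathfrak P_x\subseteq\mathfrak P$ (the island of $x$) be the set of paths starting at $x$. For a totally disconnected compact space $X$ let $\mathcal M(X)$ be the space of complex-valued finitely additive measures on the clopen subsets of $X$, i.e. the algebraic dual of the space of locally constant functions $X\to\mathbb C$. The transfer operator $\mathcal L$ acts on locally constant functions on $\mathfrak P$ by $(\mathcal Lf)(e_1e_2\cdots)=\sum_{e_0} f(e_0e_1e_2\cdots)$, the sum being over all edges $e_0$ for which $e_0e_1e_2\cdots$ is a path without backtracking; $\mathcal L'$ is the dual operator on $\mathcal M(\mathfrak P)$. Fix a base vertex $x$ of $G$. Let $\tilde T$ be the universal cover of $G$: the tree whose vertices are the finite (possibly empty) edge paths without backtracking starting at $x$, two of them being adjacent if one extends the other by one edge. Let $o$ be the empty path, and let $\pi_1$ be the fundamental group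 of $G$, acting on $\tilde T$ as the group of deck transformations, i.e. of automorphisms of $\tilde T$ that commute with the projection $\tilde T\to G$ to the end point. Let $\partial\tilde T$ be the boundary of $\tilde T$: the set of geodesic rays modulo the relation of sharing infinitely many oriented edges, with the topology generated by the sets of ends of the rays that start with a given oriented edge. Lifting paths to rays issuing from $o$ identifies $\mathfrak P_x$ with $\partial\tilde T$, so restricting measures to $\mathfrak P_x$ gives the restriction homomorphism $\operatorname{Res}:\mathcal M(\mathfrak P)\to\mathcal M(\partial\tilde T)$. For an end $\omega$ and vertices $u,v$ of $\tilde T$ put $\langle u,v\rangle_\omega:=d(u,y)-d(v,y)$, where $y$ is any vertex lying on both the ray from $u$ to $\omega$ and the ray from $v$ to $\omega$. For $z\in\mathbb C\setminus\{0\}$ an automorphism $\gamma$ of $\tilde T$ acts on $\mathcal M(\partial\tilde T)$ by the $z$-twisted action $$\pi_z(\gamma)\mu:=z^{\langle\gamma o,o\rangle_{(\cdot)}}\cdot\gamma_*\mu ,$$ i.e. $\pi_z(\gamma)\mu$ has the locally constant density $\omega\mapsto z^{\langle\gamma o,o\rangle_\omega}$ with respect to the image measure $\gamma_*\mu$. Then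 for every $z\in\mathbb C\setminus\{0\}$ the restriction homomorphism $\operatorname{Res}$ restricts to a linear isomorphism from the eigenspace $\{\mu\in\mathcal M(\mathfrak P):\mathcal L'\mu=z\mu\}$ onto the space $\{\mu\in\mathcal M(\partial\tilde T):\pi_z(\gamma)\mu=\mu\text{ for all }\gamma\in\pi_1\}$ of measures on the boundary that are invariant under the $z$-twisted action of the fundamental group. -/

import Mathlib

noncomputable section

namespace PathGraph

universe u

/-! ## Edge paths without backtracking -/

section Paths

variable {V : Type u} {G : SimpleGraph V}

/-- Two oriented edges `e`, `f` form a *turn*: `f` starts where `e` ends, and `e` is not the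
opposite of `f`. -/
def Turn (e f : G.Dart) : Prop :=
  e.snd = f.fst ∧ e ≠ f.symm

instance [DecidableEq V] (e f : G.Dart) : Decidable (Turn e f) :=
  inferInstanceAs (Decidable (_ ∧ _))

variable (G) in
/-- The path space: infinite edge paths without backtracking. -/
@[ext] structure PathSpace : Type u where
  /-- The sequence of edges. -/
  edge : ℕ → G.Dart
  turn : ∀ n, Turn (edge n) (edge (n + 1))

namespace PathSpace

instance : CoeFun (PathSpace G) (fun _ => ℕ → G.Dart) := ⟨PathSpace.edge⟩

/-- The initial vertex of an infinite path. -/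
def start (p : PathSpace G) : V := (p 0).fst

/-- The topology on the path space that has the districts (the sets of all paths with a given
finite prefix) as basic open sets. -/
instance : TopologicalSpace (PathSpace G) where
  IsOpen U := ∀ p ∈ U, ∃ n, ∀ q : PathSpace G, (∀ i < n, q i = p i) → q ∈ U
  isOpen_univ := fun _ _ => ⟨0, fun _ _ => trivial⟩
  isOpen_inter := by
    rintro s t hs ht p ⟨hps, hpt⟩
    obtain ⟨n, hn⟩ := hs p hps
    obtain ⟨m, hm⟩ := ht p hpt
    exact ⟨max n m, fun q hq => ⟨hn q fun i hi => hq i (lt_of_lt_of_le hi (le_max_left _ _)),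
      hm q fun i hi => hq i (lt_of_lt_of_le hi (le_max_right _ _))⟩⟩
  isOpen_sUnion := by
    rintro S hS p ⟨s, hs, hps⟩
    obtain ⟨n, hn⟩ := hS s hs p hps
    exact ⟨n, fun q hq => ⟨s, hs, hn q hq⟩⟩

theorem isOpen_iff {U : Set (PathSpace G)} :
    IsOpen U ↔ ∀ p ∈ U, ∃ n, ∀ q : PathSpace G, (∀ i < n, q i = p i) → q ∈ U :=
  Iff.rfl

theorem isLocallyConstant_iff {X : Type*} {f : PathSpace G → X} :
    IsLocallyConstant f ↔
      ∀ p, ∃ n, ∀ q : PathSpace G, (∀ i < n, q i = p i) → f q = f p := by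
  constructor
  · intro h p
    exact isOpen_iff.1 (h {f p}) p rfl
  · intro h s
    refine isOpen_iff.2 fun p hp => ?_
    obtain ⟨n, hn⟩ := h p
    refine ⟨n, fun q hq => ?_⟩
    change f q ∈ s
    rw [hn q hq]
    exact hp

/-- Prepend an edge to an infinite path. -/
def cons (e : G.Dart) (p : PathSpace G) (h : Turn e (p 0)) : PathSpace G :=
  ⟨fun n => Nat.casesOn n e (fun k => p k), by
    intro n
    cases n with
    | zero => exact h
    | succ k => exact p.turn k⟩

@[simp] theorem cons_zero (e : G.Dart) (p : PathSpace G) (h : Turn e (p 0)) :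
    cons e p h 0 = e := rfl

@[simp] theorem cons_succ (e : G.Dart) (p : PathSpace G) (h : Turn e (p 0)) (n : ℕ) :
    cons e p h (n + 1) = p n := rfl

/-- Drop the first `k` edges. -/
def drop (p : PathSpace G) (k : ℕ) : PathSpace G :=
  ⟨fun n => p (k + n), fun n => p.turn (k + n)⟩

@[simp] theorem drop_apply (p : PathSpace G) (k n : ℕ) : p.drop k n = p (k + n) := rfl

/-- The first `k` edges of `p`, followed by the path `q`. -/
def splice (p q : PathSpace G) (k : ℕ) (h : p k = q 0) : PathSpace G :=
  ⟨fun n => if n < k then p n else q (n - k), by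
    intro n
    rcases lt_trichotomy (n + 1) k with hn | hn | hn
    · simpa [hn, Nat.lt_of_succ_lt hn] using p.turn n
    · subst hn
      simpa [← h] using p.turn n
    · have h1 : ¬ n < k := by omega
      have h2 : ¬ n + 1 < k := by omega
      have h3 : n + 1 - k = (n - k) + 1 := by omega
      simpa [h1, h2, h3] using q.turn (n - k)⟩

theorem splice_lt (p q : PathSpace G) (k : ℕ) (h : p k = q 0) {n : ℕ} (hn : n < k) :
    splice p q k h n = p n := by
  simp [splice, hn]

theorem splice_add (p q : PathSpace G) (k : ℕ) (h : p k = q 0) (n : ℕ) :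
    splice p q k h (k + n) = q n := by
  simp [splice]

theorem splice_start (p q : PathSpace G) (k : ℕ) (h : p k = q 0) :
    (splice p q k h).start = p.start := by
  unfold start
  rcases Nat.eq_zero_or_pos k with rfl | hk
  · have := splice_add p q 0 h 0
    simp only [add_zero] at this
    rw [this, h]
  · rw [splice_lt p q k h hk]

/-- The image of a path under a graph isomorphism. -/
def map {W : Type u} {H : SimpleGraph W} (φ : G ≃g H) (p : PathSpace G) : PathSpace H :=
  ⟨fun n => φ.toHom.mapDart (p n), by
    intro n
    obtain ⟨h1, h2⟩ := p.turn n
    refine ⟨congrArg φ h1, fun h => h2 ?_⟩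
    have := congrArg SimpleGraph.Dart.toProd h
    simp only [SimpleGraph.Hom.mapDart, SimpleGraph.Dart.symm, Prod.map, Prod.swap,
      Prod.mk.injEq] at this
    apply SimpleGraph.Dart.ext
    exact Prod.ext (φ.injective this.1) (φ.injective this.2)⟩

@[simp] theorem map_apply {W : Type u} {H : SimpleGraph W} (φ : G ≃g H) (p : PathSpace G) (n : ℕ) :
    map φ p n = φ.toHom.mapDart (p n) := rfl

end PathSpace

end Paths

/-! ## Finitely additive measures -/

section Measures

variable (X : Type u) [TopologicalSpace X]

/-- Complex-valued finitely additive measures on (the clopen subsets of) a totally disconnected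
compact space `X`, as the algebraic dual of the space of locally constant functions: the measure
`μ` is the functional `f ↦ ∫ f dμ`, and the mass of a clopen set is the value of `μ` on its
characteristic function. -/
abbrev FinAddMeasure : Type u := Module.Dual ℂ (LocallyConstant X ℂ)

variable {X} {Y : Type u} [TopologicalSpace Y]

/-- The image measure: `∫ f d(φ_* μ) = ∫ f ∘ φ dμ`. -/
def FinAddMeasure.map (φ : C(X, Y)) : FinAddMeasure X →ₗ[ℂ] FinAddMeasure Y :=
  (LocallyConstant.comapₗ ℂ φ).dualMap

/-- The measure `k μ` with locally constant density `k`: `∫ f d(k μ) = ∫ k f dμ`. -/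
def FinAddMeasure.withDensity (k : LocallyConstant X ℂ) : FinAddMeasure X →ₗ[ℂ] FinAddMeasure X :=
  (LinearMap.mulLeft ℂ k).dualMap

end Measures

/-! ## The transfer operator and its dual -/

section Transfer

variable {V : Type u} [Fintype V] [DecidableEq V] (G : SimpleGraph V) [DecidableRel G.Adj]

/-- The transfer operator on locally constant functions on the path space: summation over all
extensions of a path by one edge in front. -/
def transfer : LocallyConstant (PathSpace G) ℂ →ₗ[ℂ] LocallyConstant (PathSpace G) ℂ where
  toFun f :=
    { toFun := fun p => ∑ e : G.Dart, if h : Turn e (p 0) then f (PathSpace.cons e p h) else 0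
      isLocallyConstant := by
        rw [PathSpace.isLocallyConstant_iff]
        intro p
        have key : ∀ e : G.Dart, ∃ n, ∀ q : PathSpace G, (∀ i < n, q i = p i) →
            (if h : Turn e (q 0) then f (PathSpace.cons e q h) else 0) =
              (if h : Turn e (p 0) then f (PathSpace.cons e p h) else 0) := by
          intro e
          by_cases h : Turn e (p 0)
          · obtain ⟨n, hn⟩ :=
              PathSpace.isLocallyConstant_iff.1 f.isLocallyConstant (PathSpace.cons e p h)
            refine ⟨n + 1, fun q hq => ?_⟩
            have hq0 : q 0 = p 0 := hq 0 (Nat.succ_pos _)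
            have h' : Turn e (q 0) := by rwa [hq0]
            rw [dif_pos h, dif_pos h']
            refine hn _ fun i hi => ?_
            cases i with
            | zero => rfl
            | succ i => exact hq i (by omega)
          · refine ⟨1, fun q hq => ?_⟩
            have hq0 : q 0 = p 0 := hq 0 Nat.one_pos
            have h' : ¬ Turn e (q 0) := by rwa [hq0]
            rw [dif_neg h, dif_neg h']
        choose n hn using key
        refine ⟨Finset.univ.sup n, fun q hq => Finset.sum_congr rfl fun e _ => ?_⟩
        exact hn e q fun i hi => hq i (lt_of_lt_of_le hi (Finset.le_sup (Finset.mem_univ e))) }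
  map_add' f g := by
    ext p
    simp only [LocallyConstant.coe_mk, LocallyConstant.add_apply]
    rw [← Finset.sum_add_distrib]
    refine Finset.sum_congr rfl fun e _ => ?_
    split_ifs <;> simp
  map_smul' c f := by
    ext p
    simp only [LocallyConstant.coe_mk, LocallyConstant.smul_apply, RingHom.id_apply, smul_eq_mul]
    rw [Finset.mul_sum]
    refine Finset.sum_congr rfl fun e _ => ?_
    split_ifs <;> simp

/-- The dual transfer operator on finitely additive measures. -/
def dualTransfer : Module.End ℂ (FinAddMeasure (PathSpace G)) :=
  (transfer G).dualMap

end Transfer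

/-! ## Restriction to an island -/

section Island

variable {V : Type u} (G : SimpleGraph V) (x : V)

/-- The island designated by the vertex `x`: all infinite paths that start at `x`. -/
abbrev Island : Type u := {p : PathSpace G // p.start = x}

open Classical in
/-- Extension of a locally constant function by zero outside of an island. -/
def extendByZero : LocallyConstant (Island G x) ℂ →ₗ[ℂ] LocallyConstant (PathSpace G) ℂ where
  toFun f :=
    { toFun := fun p => if h : p.start = x then f ⟨p, h⟩ else 0
      isLocallyConstant := by
        rw [PathSpace.isLocallyConstant_iff]
        intro p
        by_cases h : p.start = x
        · obtain ⟨U, hU, hUf⟩ := isOpen_induced_iff.1 (f.isLocallyConstant {f ⟨p, h⟩})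
          have hp : p ∈ U := by
            have : (⟨p, h⟩ : Island G x) ∈ Subtype.val ⁻¹' U := by rw [hUf]; rfl
            exact this
          obtain ⟨n, hn⟩ := PathSpace.isOpen_iff.1 hU p hp
          refine ⟨n + 1, fun q hq => ?_⟩
          have hq0 : q.start = x := by
            rw [← h]; exact congrArg (fun e : G.Dart => e.fst) (hq 0 (Nat.succ_pos _))
          rw [dif_pos h, dif_pos hq0]
          have : (⟨q, hq0⟩ : Island G x) ∈ Subtype.val ⁻¹' U :=
            hn q fun i hi => hq i (by omega)
          rw [hUf] at this
          exact this
        · refine ⟨1, fun q hq => ?_⟩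
          have hq0 : q.start = p.start :=
            congrArg (fun e : G.Dart => e.fst) (hq 0 Nat.one_pos)
          rw [dif_neg h, dif_neg (by rwa [hq0])] }
  map_add' f g := by
    ext p
    simp only [LocallyConstant.coe_mk, LocallyConstant.add_apply]
    split_ifs <;> simp
  map_smul' c f := by
    ext p
    simp only [LocallyConstant.coe_mk, LocallyConstant.smul_apply, RingHom.id_apply, smul_eq_mul]
    split_ifs <;> simp

/-- Restriction of a finitely additive measure on the path space to an island. -/
def restrictIsland : FinAddMeasure (PathSpace G) →ₗ[ℂ] FinAddMeasure (Island G x) :=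
  (extendByZero G x).dualMap

end Island

/-! ## Trees: the boundary and the horocycle cocycle -/

section Tree

variable {W : Type u} {T : SimpleGraph W}

/-- Two rays are confluent if they share infinitely many (oriented) edges. -/
def Confluent (r s : PathSpace T) : Prop :=
  (Set.range r.edge ∩ Set.range s.edge).Infinite

theorem tree_parent_unique (hT : T.IsTree) {u a b c : W} (hab : T.Adj a b) (hcb : T.Adj c b)
    (ha : T.dist u a + 1 = T.dist u b) (hc : T.dist u c + 1 = T.dist u b) : a = c := by
  have key : ∀ {d : W} (hdb : T.Adj d b), T.dist u d + 1 = T.dist u b →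
      ∃ p : T.Walk u b, p.IsPath ∧ p.penultimate = d := by
    intro d hdb hd
    obtain ⟨p, hp⟩ := (hT.connected.preconnected u d).exists_walk_length_eq_dist
    refine ⟨p.concat hdb, ?_, by simp⟩
    apply SimpleGraph.Walk.isPath_of_length_eq_dist
    rw [SimpleGraph.Walk.length_concat, hp, hd]
  obtain ⟨p, hp, hpa⟩ := key hab ha
  obtain ⟨q, hq, hqc⟩ := key hcb hc
  have hpq : p = q := (hT.existsUnique_path u b).unique hp hq
  rw [← hpa, ← hqc, hpq]

theorem ray_dist_aux (hT : T.IsTree) (r : PathSpace T) (n : ℕ) :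
    T.dist r.start (r n).fst = n ∧ T.dist r.start (r n).snd = n + 1 := by
  induction n with
  | zero =>
    refine ⟨by simp [PathSpace.start], ?_⟩
    simp only [PathSpace.start, zero_add]
    exact SimpleGraph.dist_eq_one_iff_adj.2 (r 0).adj
  | succ n ih =>
    obtain ⟨h1, h2⟩ := ih
    obtain ⟨t1, t2⟩ := r.turn n
    have h3 : T.dist r.start (r (n + 1)).fst = n + 1 := by rw [← t1, h2]
    refine ⟨h3, ?_⟩
    rcases hT.dist_eq_dist_add_one_of_adj r.start (r (n + 1)).adj with h | h
    · exfalso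
      apply t2
      have : (r n).fst = (r (n + 1)).snd := by
        refine tree_parent_unique hT (u := r.start) (b := (r (n + 1)).fst) ?_
          (r (n + 1)).adj.symm ?_ h.symm
        · rw [← t1]; exact (r n).adj
        · rw [h1, h3]
      apply SimpleGraph.Dart.ext
      exact Prod.ext this t1
    · rw [h, h3]

theorem ray_dist (hT : T.IsTree) (r : PathSpace T) (n : ℕ) : T.dist r.start (r n).fst = n :=
  (ray_dist_aux hT r n).1

theorem ray_injective (hT : T.IsTree) (r : PathSpace T) : Function.Injective r.edge := by
  intro m n h
  have h1 := ray_dist hT r m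
  have h2 := ray_dist hT r n
  have h3 : (r m).fst = (r n).fst := congrArg (fun e : T.Dart => e.fst) h
  rw [h3] at h1
  omega

/-- Rays with the same start that share an edge or vertex agree before it. -/
theorem ray_agree (hT : T.IsTree) (r s : PathSpace T) (h0 : r.start = s.start) (n : ℕ)
    (h : (r n).fst = (s n).fst) : ∀ k < n, r k = s k := by
  induction n with
  | zero => intro k hk; omega
  | succ n ih =>
    have hr := (r.turn n).1
    have hs := (s.turn n).1
    have e2 : (r n).snd = (s n).snd := by rw [hr, hs, h]
    have e1 : (r n).fst = (s n).fst := by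
      refine tree_parent_unique hT (u := r.start) (b := (r n).snd) (r n).adj ?_ ?_ ?_
      · rw [e2]; exact (s n).adj
      · rw [(ray_dist_aux hT r n).1, (ray_dist_aux hT r n).2]
      · rw [(ray_dist_aux hT r n).2, h0, (ray_dist_aux hT s n).1]
    intro k hk
    rcases Nat.lt_succ_iff_lt_or_eq.1 hk with hk | rfl
    · exact ih e1 k hk
    · exact SimpleGraph.Dart.ext _ _ (Prod.ext e1 e2)

/-- In a tree, confluent rays agree eventually. -/
theorem confluent_iff (hT : T.IsTree) (r s : PathSpace T) :
    Confluent r s ↔ ∃ m n, ∀ k, r (m + k) = s (n + k) := by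
  constructor
  · intro h
    obtain ⟨e, ⟨i, hi⟩, ⟨j, hj⟩⟩ := h.nonempty
    refine ⟨i, j, fun k => ?_⟩
    have hfin : ((fun a => r.edge a) '' Set.Iic (i + k) ∪ (fun a => s.edge a) '' Set.Iic j).Finite :=
      ((Set.finite_Iic _).image _).union ((Set.finite_Iic _).image _)
    obtain ⟨f, ⟨⟨i', hi'⟩, ⟨j', hj'⟩⟩, hf⟩ := h.exists_notMem_finite hfin
    have hi1 : i + k < i' := by
      by_contra hcon
      exact hf (Or.inl ⟨i', Set.mem_Iic.2 (by omega), hi'⟩)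
    have hj1 : j < j' := by
      by_contra hcon
      exact hf (Or.inr ⟨j', Set.mem_Iic.2 (by omega), hj'⟩)
    have hstart : (r.drop i).start = (s.drop j).start := by
      change (r.edge (i + 0)).fst = (s.edge (j + 0)).fst
      rw [add_zero, add_zero, hi, hj]
    have e1 : (r.drop i) (i' - i) = f := by
      rw [PathSpace.drop_apply, Nat.add_sub_cancel' (by omega)]; exact hi'
    have e2 : (s.drop j) (j' - j) = f := by
      rw [PathSpace.drop_apply, Nat.add_sub_cancel' (by omega)]; exact hj'
    have d1 := ray_dist hT (r.drop i) (i' - i)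
    have d2 := ray_dist hT (s.drop j) (j' - j)
    rw [e1, hstart] at d1
    rw [e2] at d2
    have hab : i' - i = j' - j := by rw [← d1, ← d2]
    have := ray_agree hT (r.drop i) (s.drop j) hstart (i' - i)
      (by rw [e1, hab, e2]) k (by omega)
    simpa using this
  · rintro ⟨m, n, h⟩
    have hinj : Function.Injective (fun k => r.edge (m + k)) := by
      intro a b hab
      have := ray_injective hT r hab
      omega
    refine (Set.infinite_range_of_injective hinj).mono ?_
    rintro _ ⟨k, rfl⟩
    exact ⟨⟨_, rfl⟩, ⟨n + k, (h k).symm⟩⟩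

/-- Confluence is an equivalence relation on the set of rays of a tree. -/
def confluenceSetoid (hT : T.IsTree) : Setoid (PathSpace T) where
  r := Confluent
  iseqv :=
    { refl := fun r => (confluent_iff hT r r).2 ⟨0, 0, fun _ => rfl⟩
      symm := by
        intro r s h
        unfold Confluent at h ⊢
        rwa [Set.inter_comm]
      trans := by
        intro r s t h1 h2
        obtain ⟨m, n, h1⟩ := (confluent_iff hT r s).1 h1
        obtain ⟨m', n', h2⟩ := (confluent_iff hT s t).1 h2
        refine (confluent_iff hT r t).2 ⟨m + m', n' + n, fun k => ?_⟩
        have e1 := h1 (m' + k)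
        have e2 := h2 (n + k)
        rw [show m + m' + k = m + (m' + k) by omega, e1,
          show n' + n + k = n' + (n + k) by omega, ← e2,
          show n + (m' + k) = m' + (n + k) by omega] }

/-- The boundary of a tree: the set of ends, i.e. of classes of confluent rays. -/
def Boundary (hT : T.IsTree) : Type u := Quotient (confluenceSetoid hT)

/-- The end of a ray. -/
def Boundary.mk (hT : T.IsTree) (r : PathSpace T) : Boundary hT :=
  Quotient.mk (confluenceSetoid hT) r

theorem Boundary.mk_eq (hT : T.IsTree) {r s : PathSpace T} :
    Boundary.mk hT r = Boundary.mk hT s ↔ ∃ m n, ∀ k, r (m + k) = s (n + k) := by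
  rw [← confluent_iff hT]
  exact Quotient.eq (r := confluenceSetoid hT)

/-- The forward subset of an oriented edge: the ends of all rays that start with the edge. -/
def Boundary.forward (hT : T.IsTree) (e : T.Dart) : Set (Boundary hT) :=
  {ω | ∃ r : PathSpace T, r 0 = e ∧ Boundary.mk hT r = ω}

/-- The topology on the boundary, generated by the forward subsets. -/
instance (hT : T.IsTree) : TopologicalSpace (Boundary hT) :=
  TopologicalSpace.generateFrom (Set.range (Boundary.forward hT))

theorem Boundary.isOpen_forward (hT : T.IsTree) (e : T.Dart) : IsOpen (Boundary.forward hT e) :=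
  TopologicalSpace.isOpen_generateFrom_of_mem ⟨e, rfl⟩

theorem exists_rayTo (hT : T.IsTree) (u : W) (ω : Boundary hT) :
    ∃ r : PathSpace T, r.start = u ∧ Boundary.mk hT r = ω := by
  obtain ⟨r₀, rfl⟩ := Quotient.exists_rep ω
  have step : ∀ v w : W, T.Adj v w → (∃ r : PathSpace T, r.start = v ∧
      Boundary.mk hT r = Boundary.mk hT r₀) → (∃ r : PathSpace T, r.start = w ∧
      Boundary.mk hT r = Boundary.mk hT r₀) := by
    rintro v w hvw ⟨r, hr, hω⟩
    by_cases hw : (r 0).snd = w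
    · refine ⟨r.drop 1, ?_, ?_⟩
      · rw [← hw]; exact (r.turn 0).1.symm
      · rw [← hω]
        exact (Boundary.mk_eq hT).2 ⟨0, 1, fun k => by simp⟩
    · have ht : Turn (⟨(w, v), hvw.symm⟩ : T.Dart) (r 0) := by
        refine ⟨hr.symm, fun h => hw ?_⟩
        exact (congrArg (fun e : T.Dart => e.fst) h).symm
      refine ⟨PathSpace.cons _ r ht, rfl, ?_⟩
      rw [← hω]
      refine (Boundary.mk_eq hT).2 ⟨1, 0, fun k => ?_⟩
      rw [add_comm, zero_add]
      rfl
  obtain ⟨p⟩ := hT.connected.preconnected r₀.start u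
  have walk : ∀ {v w : W} (_ : T.Walk v w), (∃ r : PathSpace T, r.start = v ∧
      Boundary.mk hT r = Boundary.mk hT r₀) → (∃ r : PathSpace T, r.start = w ∧
      Boundary.mk hT r = Boundary.mk hT r₀) := by
    intro v w p
    induction p with
    | nil => exact id
    | cons h _ ih => exact fun hv => ih (step _ _ h hv)
  exact walk p ⟨r₀, rfl, rfl⟩

/-- The geodesic ray from the vertex `u` to the end `ω`. -/
def rayTo (hT : T.IsTree) (u : W) (ω : Boundary hT) : PathSpace T :=
  (exists_rayTo hT u ω).choose

theorem rayTo_start (hT : T.IsTree) (u : W) (ω : Boundary hT) : (rayTo hT u ω).start = u :=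
  (exists_rayTo hT u ω).choose_spec.1

theorem mk_rayTo (hT : T.IsTree) (u : W) (ω : Boundary hT) :
    Boundary.mk hT (rayTo hT u ω) = ω :=
  (exists_rayTo hT u ω).choose_spec.2

/-- The ray from a vertex to an end is unique. -/
theorem ray_unique (hT : T.IsTree) {r s : PathSpace T} (h0 : r.start = s.start)
    (h : Boundary.mk hT r = Boundary.mk hT s) : r = s := by
  obtain ⟨m, n, h⟩ := (Boundary.mk_eq hT).1 h
  have hmn : m = n := by
    have d1 := ray_dist hT r m
    have d2 := ray_dist hT s n
    have e := h 0
    simp only [add_zero] at e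
    rw [e, h0, d2] at d1
    exact d1.symm
  subst hmn
  refine PathSpace.ext (funext fun k => ?_)
  have e := h k
  exact ray_agree hT r s h0 (m + k + 1) (by
    have e' := h (k + 1)
    rw [← add_assoc] at e'
    rw [e']) k (by omega)

theorem eq_rayTo (hT : T.IsTree) {u : W} {ω : Boundary hT} {r : PathSpace T} (h0 : r.start = u)
    (h : Boundary.mk hT r = ω) : rayTo hT u ω = r :=
  ray_unique hT (by rw [rayTo_start, h0]) (by rw [mk_rayTo, h])

theorem exists_common_vertex (hT : T.IsTree) (ω : Boundary hT) (u v : W) :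
    ∃ y : W, (∃ i, (rayTo hT u ω i).fst = y) ∧ (∃ j, (rayTo hT v ω j).fst = y) := by
  have h : Boundary.mk hT (rayTo hT u ω) = Boundary.mk hT (rayTo hT v ω) := by
    rw [mk_rayTo, mk_rayTo]
  obtain ⟨m, n, h⟩ := (Boundary.mk_eq hT).1 h
  exact ⟨_, ⟨m, rfl⟩, ⟨n, by have := h 0; simp only [add_zero] at this; rw [this]⟩⟩

/-- The horocyclic difference of the vertices `u` and `v` with respect to the end `ω`:
`d(u, y) - d(v, y)`, where `y` is any vertex common to the rays from `u` and from `v` to `ω`. -/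
def horoDist (hT : T.IsTree) (ω : Boundary hT) (u v : W) : ℤ :=
  (T.dist u (exists_common_vertex hT ω u v).choose : ℤ) -
    (T.dist v (exists_common_vertex hT ω u v).choose : ℤ)

/-- The horocyclic difference does not depend on the choice of the common vertex. -/
theorem horoDist_eq (hT : T.IsTree) (ω : Boundary hT) (u v : W) (i j : ℕ)
    (h : (rayTo hT u ω i).fst = (rayTo hT v ω j).fst) :
    horoDist hT ω u v = (i : ℤ) - (j : ℤ) := by
  obtain ⟨⟨i', hi'⟩, ⟨j', hj'⟩⟩ := (exists_common_vertex hT ω u v).choose_spec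
  have d1 := ray_dist hT (rayTo hT u ω) i'
  have d2 := ray_dist hT (rayTo hT v ω) j'
  rw [rayTo_start, hi'] at d1
  rw [rayTo_start, hj'] at d2
  unfold horoDist
  rw [d1, d2]
  have key : ∀ a b : ℕ, (rayTo hT u ω a).fst = (rayTo hT v ω b).fst →
      ∀ k, rayTo hT u ω (a + k) = rayTo hT v ω (b + k) := by
    intro a b hab k
    have : (rayTo hT u ω).drop a = (rayTo hT v ω).drop b := by
      refine ray_unique hT hab ?_
      have e1 : Boundary.mk hT ((rayTo hT u ω).drop a) = ω := by
        conv_rhs => rw [← mk_rayTo hT u ω]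
        exact (Boundary.mk_eq hT).2 ⟨0, a, fun k => by simp⟩
      have e2 : Boundary.mk hT ((rayTo hT v ω).drop b) = ω := by
        conv_rhs => rw [← mk_rayTo hT v ω]
        exact (Boundary.mk_eq hT).2 ⟨0, b, fun k => by simp⟩
      rw [e1, e2]
    have := congrArg (fun r : PathSpace T => r k) this
    simpa using this
  have k1 := key i j h i'
  have k2 := key i' j' (hi'.trans hj'.symm) i
  rw [add_comm i' i] at k2
  have := ray_injective hT (rayTo hT v ω) (k1.symm.trans k2)
  omega

theorem horoDist_isLocallyConstant (hT : T.IsTree) (u v : W) :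
    IsLocallyConstant (fun ω : Boundary hT => horoDist hT ω u v) := by
  rw [IsLocallyConstant.iff_exists_open]
  intro ω
  have h : Boundary.mk hT (rayTo hT u ω) = Boundary.mk hT (rayTo hT v ω) := by
    rw [mk_rayTo, mk_rayTo]
  obtain ⟨m, n, h⟩ := (Boundary.mk_eq hT).1 h
  have h0 : rayTo hT u ω m = rayTo hT v ω n := by simpa using h 0
  have near : ∀ (w : W) (a : ℕ) (ω' : Boundary hT) (s : PathSpace T), Boundary.mk hT s = ω' →
      (hs : rayTo hT w ω a = s 0) → rayTo hT w ω' a = s 0 := by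
    intro w a ω' s hω' hs
    have : rayTo hT w ω' = (rayTo hT w ω).splice s a hs := by
      refine eq_rayTo hT ?_ ?_
      · rw [PathSpace.splice_start, rayTo_start]
      · rw [← hω']
        refine (Boundary.mk_eq hT).2 ⟨a, 0, fun k => ?_⟩
        rw [PathSpace.splice_add, zero_add]
    rw [this]
    simpa using PathSpace.splice_add (rayTo hT w ω) s a hs 0
  refine ⟨Boundary.forward hT (rayTo hT u ω m), Boundary.isOpen_forward hT _, ?_, ?_⟩
  · refine ⟨(rayTo hT u ω).drop m, by simp, ?_⟩
    conv_rhs => rw [← mk_rayTo hT u ω]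
    exact (Boundary.mk_eq hT).2 ⟨0, m, fun k => by simp⟩
  · rintro ω' ⟨s, hs0, hsω⟩
    rw [horoDist_eq hT ω u v m n (by rw [h0])]
    refine horoDist_eq hT ω' u v m n ?_
    rw [near u m ω' s hsω hs0.symm, near v n ω' s hsω (by rw [← h0, hs0])]

/-- The locally constant function `ω ↦ z ^ ⟨v, u⟩_ω` on the boundary, where `⟨v, u⟩_ω` is the
horocyclic difference of `v` and `u` with respect to `ω`. -/
def cocycle (hT : T.IsTree) (z : ℂ) (v u : W) : LocallyConstant (Boundary hT) ℂ where
  toFun ω := z ^ horoDist hT ω v u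
  isLocallyConstant := (horoDist_isLocallyConstant hT v u).comp (fun n : ℤ => z ^ n)

/-- The action of a tree automorphism on the boundary. -/
def Boundary.aut (hT : T.IsTree) (γ : T ≃g T) : C(Boundary hT, Boundary hT) where
  toFun := Quotient.lift (fun r => Boundary.mk hT (PathSpace.map γ r)) (by
    intro r s h
    obtain ⟨m, n, h⟩ := (confluent_iff hT r s).1 h
    exact (Boundary.mk_eq hT).2 ⟨m, n, fun k => by simp [h k]⟩)
  continuous_toFun := by
    refine continuous_generateFrom_iff.2 ?_
    rintro _ ⟨e, rfl⟩
    rw [isOpen_iff_forall_mem_open]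
    intro ω hω
    obtain ⟨r, rfl⟩ := Quotient.exists_rep ω
    obtain ⟨s, hs, hsr⟩ := hω
    obtain ⟨m, n, h⟩ := (Boundary.mk_eq hT).1 (hsr : Boundary.mk hT s = Boundary.mk hT _)
    refine ⟨Boundary.forward hT (γ.symm.toHom.mapDart e), ?_, Boundary.isOpen_forward hT _, ?_⟩
    · rintro _ ⟨t, ht, rfl⟩
      refine ⟨PathSpace.map γ t, ?_, rfl⟩
      rw [PathSpace.map_apply, ht]
      apply SimpleGraph.Dart.ext
      simp [SimpleGraph.Hom.mapDart, Prod.map]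
    · refine ⟨PathSpace.map γ.symm s, by simp [hs], ?_⟩
      refine (Boundary.mk_eq hT).2 ⟨m, n, fun k => ?_⟩
      rw [PathSpace.map_apply, h k]
      apply SimpleGraph.Dart.ext
      simp [SimpleGraph.Hom.mapDart, Prod.map]

/-- The `z`-twisted action of an automorphism `γ` on the finitely additive measures on the
boundary, relative to the base vertex `o`: `μ` is sent to the measure with density
`ω ↦ z ^ ⟨γ o, o⟩_ω` with respect to the image measure `γ μ`. -/
def twistedAction (hT : T.IsTree) (o : W) (z : ℂ) (γ : T ≃g T) :
    FinAddMeasure (Boundary hT) →ₗ[ℂ] FinAddMeasure (Boundary hT) :=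
  FinAddMeasure.withDensity (cocycle hT z (γ o) o) ∘ₗ FinAddMeasure.map (Boundary.aut hT γ)

/-- The measures on the boundary that are invariant under the `z`-twisted action of a group of
automorphisms. -/
def twistedInvariants (hT : T.IsTree) (o : W) (z : ℂ) (Γ : Subgroup (T ≃g T)) :
    Submodule ℂ (FinAddMeasure (Boundary hT)) where
  carrier := {μ | ∀ γ ∈ Γ, twistedAction hT o z γ μ = μ}
  add_mem' := by
    intro μ ν hμ hν γ hγ
    rw [map_add, hμ γ hγ, hν γ hγ]
  zero_mem' := fun γ _ => map_zero _
  smul_mem' := by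
    intro c μ hμ γ hγ
    rw [map_smul, hμ γ hγ]

end Tree

/-! ## The universal cover -/

section UniversalCover

variable {V : Type u} (G : SimpleGraph V) (x : V)

/-- The vertices of the universal cover of `G` with base vertex `x`: the (possibly empty) finite
edge paths without backtracking that start at `x`. -/
@[ext] structure CoverVertex : Type u where
  /-- The list of edges. -/
  edges : List G.Dart
  chain : edges.IsChain Turn
  head : ∀ e ∈ edges.head?, e.fst = x

/-- The universal cover: two finite paths are adjacent if one extends the other by one edge. -/
def universalCover : SimpleGraph (CoverVertex G x) where
  Adj a b := (∃ e, b.edges = a.edges ++ [e]) ∨ (∃ e, a.edges = b.edges ++ [e])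
  symm := ⟨fun _ _ h => h.symm⟩
  loopless := ⟨by
    rintro a (⟨e, h⟩ | ⟨e, h⟩) <;> simpa using congrArg List.length h⟩

/-- The base vertex upstairs: the empty path. -/
def coverBase : CoverVertex G x := ⟨[], by simp, by simp⟩

variable {G x} in
/-- The covering projection, which sends a path to its end point. -/
def coverProj (a : CoverVertex G x) : V :=
  (a.edges.getLast?.map (fun e : G.Dart => e.snd)).getD x

/-- The fundamental group, as the group of deck transformations of the universal cover. -/
def deckGroup : Subgroup (universalCover G x ≃g universalCover G x) where
  carrier := {γ | ∀ a, coverProj (γ a) = coverProj a}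
  mul_mem' := by
    intro γ δ hγ hδ a
    change coverProj (γ (δ a)) = coverProj a
    rw [hγ, hδ]
  one_mem' := fun _ => rfl
  inv_mem' := by
    intro γ hγ a
    have := hγ (γ⁻¹ a)
    rw [← this]
    exact congrArg coverProj (RelIso.apply_inv_self γ a)

theorem universalCover_isTree : (universalCover G x).IsTree := by
  constructor
  · have hbase : ∀ (n : ℕ) (a : CoverVertex G x), a.edges.length = n →
        (universalCover G x).Reachable (coverBase G x) a := by
      intro n
      induction n with
      | zero =>
        intro a ha
        have : a = coverBase G x := CoverVertex.ext (List.length_eq_zero_iff.1 ha)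
        rw [this]
      | succ n ih =>
        rintro ⟨c, hc1, hc2⟩ ha
        rcases List.eq_nil_or_concat c with rfl | ⟨l, e, rfl⟩
        · simp at ha
        · rw [List.concat_eq_append] at hc1 hc2
          have hl : l.IsChain Turn := (List.isChain_append.1 hc1).1
          have hl2 : ∀ e ∈ l.head?, e.fst = x := by
            intro f hf
            apply hc2
            cases l with
            | nil => simp at hf
            | cons g l => simpa using hf
          refine (ih ⟨l, hl, hl2⟩ (by simpa using ha)).trans ?_
          exact SimpleGraph.Adj.reachable (Or.inl ⟨e, List.concat_eq_append⟩)
    have : Nonempty (CoverVertex G x) := ⟨coverBase G x⟩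
    exact SimpleGraph.Connected.mk fun a b => (hbase _ a rfl).symm.trans (hbase _ b rfl)
  · rw [SimpleGraph.isAcyclic_iff_forall_adj_isBridge]
    have key : ∀ (a b : CoverVertex G x) (e : G.Dart), b.edges = a.edges ++ [e] →
        (universalCover G x).IsBridge s(a, b) := by
      intro a b e hb
      rw [SimpleGraph.isBridge_iff]
      intro hreach
      obtain ⟨p⟩ := hreach.symm
      have inv : ∀ {v w : CoverVertex G x}
          (_ : ((universalCover G x).deleteEdges {s(a, b)}).Walk v w),
          b.edges <+: v.edges → b.edges <+: w.edges := by
        intro v w p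
        induction p with
        | nil => exact id
        | @cons v v' w h _ ih =>
          intro hv
          apply ih
          rw [SimpleGraph.deleteEdges_adj] at h
          obtain ⟨h | h, hne⟩ := h
          · obtain ⟨f, hf⟩ := h
            rw [hf]
            exact hv.trans (List.prefix_append _ _)
          · obtain ⟨f, hf⟩ := h
            rw [hf] at hv
            rcases List.prefix_concat_iff.1 hv with h' | h'
            · exfalso
              apply hne
              have e1 : v = b := CoverVertex.ext (hf.trans h'.symm)
              have e2 : v' = a := by
                apply CoverVertex.ext
                have := h'.symm.trans hb
                exact (List.append_inj' this rfl).1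
              rw [e1, e2]
              exact Sym2.eq_swap
            · exact h'
      have := (inv p (List.prefix_refl _)).length_le
      rw [hb] at this
      simp at this
    rintro a b (⟨e, h⟩ | ⟨e, h⟩)
    · exact key a b e h
    · rw [Sym2.eq_swap]; exact key b a e h

/-- The boundary of the universal cover. -/
abbrev CoverBoundary : Type u := Boundary (universalCover_isTree G x)

variable {G x}

/-- The prefix of length `n` of a path in the island of `x`, as a vertex of the universal cover. -/
def pathPrefix (p : Island G x) (n : ℕ) : CoverVertex G x :=
  ⟨(List.range n).map p.1.edge, by
    · rw [List.isChain_map]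
      induction n with
      | zero => simp
      | succ n ih =>
        rw [List.range_succ, List.isChain_append]
        refine ⟨ih, by simp, ?_⟩
        intro a ha b hb
        have hb' : b = n := by simpa using hb.symm
        cases n with
        | zero => simp at ha
        | succ m =>
          have ha' : a = m := by
            rw [List.range_succ] at ha
            simpa using ha.symm
          subst ha' hb'
          exact p.1.turn a, by
    · cases n with
      | zero => simp
      | succ n =>
        intro e he
        rw [List.range_succ_eq_map] at he
        have he' : e = p.1 0 := by simpa using he.symm
        rw [he']
        exact p.2⟩

theorem pathPrefix_succ (p : Island G x) (n : ℕ) :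
    (pathPrefix p (n + 1)).edges = (pathPrefix p n).edges ++ [p.1 n] := by
  simp [pathPrefix, List.range_succ]

/-- The lift of a path in the island of `x` to the ray in the universal cover that starts at the
base vertex. -/
def liftPath (p : Island G x) : PathSpace (universalCover G x) :=
  ⟨fun n => ⟨(pathPrefix p n, pathPrefix p (n + 1)), Or.inl ⟨p.1 n, pathPrefix_succ p n⟩⟩, by
    intro n
    refine ⟨rfl, fun h => ?_⟩
    have := congrArg (fun e : (universalCover G x).Dart => e.fst.edges.length) h
    have h' : n = n + 1 + 1 := by simpa [pathPrefix, SimpleGraph.Dart.symm] using this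
    omega⟩

/-- The identification of the island of the base vertex with the boundary of the universal
cover. -/
def islandToBoundary : C(Island G x, CoverBoundary G x) where
  toFun p := Boundary.mk _ (liftPath p)
  continuous_toFun := by
    refine continuous_generateFrom_iff.2 ?_
    rintro _ ⟨e, rfl⟩
    rw [isOpen_iff_forall_mem_open]
    rintro p ⟨s, hs, hsp⟩
    obtain ⟨m, n, h⟩ := (Boundary.mk_eq _).1 hsp
    refine ⟨Subtype.val ⁻¹' {q : PathSpace G | ∀ i < n + 1, q i = p.1 i}, ?_, ?_,
      fun i _ => rfl⟩
    · intro q hq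
      have hpre : ∀ k ≤ n + 1, pathPrefix q k = pathPrefix p k := by
        intro k hk
        apply CoverVertex.ext
        refine List.map_congr_left fun i hi => hq i ?_
        have := List.mem_range.1 hi
        omega
      have hd : s m = (liftPath q).drop n 0 := by
        have h0 := h 0
        simp only [add_zero] at h0
        rw [h0]
        apply SimpleGraph.Dart.ext
        exact Prod.ext (hpre n (by omega)).symm (hpre (n + 1) le_rfl).symm
      refine ⟨s.splice ((liftPath q).drop n) m hd, ?_, ?_⟩
      · rcases Nat.eq_zero_or_pos m with rfl | hm
        · have := PathSpace.splice_add s ((liftPath q).drop n) 0 hd 0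
          simp only [add_zero] at this
          rw [this, ← hd, hs]
        · rw [PathSpace.splice_lt _ _ _ _ hm, hs]
      · exact (Boundary.mk_eq _).2 ⟨m, n, fun k => by rw [PathSpace.splice_add]; rfl⟩
    · refine isOpen_induced (PathSpace.isOpen_iff.2 fun q hq => ⟨n + 1, fun q' hq' i hi => ?_⟩)
      rw [hq' i hi, hq i hi]

variable (G x)

/-- The restriction homomorphism: restrict a finitely additive measure on the path space to the
island of `x` and regard it as a measure on the boundary of the universal cover. -/
def restriction : FinAddMeasure (PathSpace G) →ₗ[ℂ] FinAddMeasure (CoverBoundary G x) :=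
  FinAddMeasure.map islandToBoundary ∘ₗ restrictIsland G x

end UniversalCover

end PathGraph

end

/-! The transfer operator strips the first edge of a cylinder function. For a finite path `l` ending
in the edge `e`, let `shiftCylinder l g` be supported on the paths with prefix `l`, with value `g`
at the path that begins with that last edge. If `l` has at least two edges, deleting the first one
is exactly the effect of `transfer` (`transfer_shiftCylinder`). For an eigenmeasure `μ` of
eigenvalue `z`, the number `z ^ |l| * μ (shiftCylinder l g)` therefore depends only on `e` and `g`.
On the island of `x` this is the condition `IsConformal`.

Conversely, a conformal measure on the island determines the eigenmeasure: every oriented edge `e`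
is the last edge of some path issuing from `x`, and the mass near `e` is read off from the cylinder
of that path. That `e` can be reached is a counting argument, using connectedness and degrees at
least 2 (`mem_of_turn_closed`). This yields injectivity (`eigenmeasure_eq_zero`) and surjectivity
onto conformal measures (`exists_eigenmeasure`).

Conformality is in turn twisted invariance (`map_mem_twistedInvariants_iff`). Finite paths `a`, `b`
with the same last edge are vertices of the tree in one fibre, so some deck transformation takes `a`
to `b`. It carries the ends beyond `a` to the ends beyond `b`, and there the density is `z ^ (|a| -
|b|)`. In the other direction, an inverse deck transformation keeps the last edge of every
sufficiently long path, and functions supported on the cylinders of long paths span all locally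
constant functions. -/

noncomputable section

namespace PathGraph

universe u

/-! ### Cylinder functions and the transfer operator -/

section Cylinders

variable {V : Type u} {G : SimpleGraph V}

namespace PathSpace

/-- The list of the first `n` edges of a path. -/
def take (p : PathSpace G) (n : ℕ) : List G.Dart := (List.range n).map p.edge

@[simp] theorem length_take (p : PathSpace G) (n : ℕ) : (p.take n).length = n := by
  simp [take]

theorem take_succ (p : PathSpace G) (n : ℕ) : p.take (n + 1) = p.take n ++ [p n] := by
  simp [take, List.range_succ]

theorem take_succ' (p : PathSpace G) (n : ℕ) :
    p.take (n + 1) = p 0 :: (p.drop 1).take n := by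
  simp only [take, List.range_succ_eq_map, List.map_cons, List.map_map]
  congr 1
  refine List.map_congr_left fun i _ => ?_
  simp [add_comm 1 i]

theorem take_congr {p q : PathSpace G} {n : ℕ} (h : ∀ i < n, q i = p i) : q.take n = p.take n :=
  List.map_congr_left fun i hi => h i (List.mem_range.1 hi)

theorem drop_drop (p : PathSpace G) (m n : ℕ) : (p.drop m).drop n = p.drop (m + n) := by
  ext k
  all_goals simp [add_assoc]

theorem cons_drop (p : PathSpace G) (n : ℕ) (h : Turn (p n) (p.drop (n + 1) 0)) :
    cons (p n) (p.drop (n + 1)) h = p.drop n := by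
  refine PathSpace.ext (funext fun k => ?_)
  cases k with
  | zero => rfl
  | succ k => change p (n + 1 + k) = p (n + (k + 1)); congr 1; omega

theorem drop_cons (e : G.Dart) (p : PathSpace G) (h : Turn e (p 0)) : (cons e p h).drop 1 = p := by
  refine PathSpace.ext (funext fun k => ?_)
  change cons e p h (1 + k) = p k
  rw [add_comm, cons_succ]

theorem start_eq_of_take {p : PathSpace G} {l : List G.Dart} {x : V} (hl : l ≠ [])
    (hx : ∀ e ∈ l.head?, e.fst = x) (h : p.take l.length = l) : p.start = x := by
  cases l with
  | nil => exact absurd rfl hl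
  | cons e l =>
    rw [List.length_cons, take_succ', List.cons.injEq] at h
    exact (congrArg (fun d : G.Dart => d.fst) h.1).trans (hx e (by simp))

/-- A finite path `l` can be continued by an infinite path `q`. -/
theorem exists_take_drop {l : List G.Dart} (hl : l.IsChain Turn) (q : PathSpace G)
    (h : ∀ e ∈ l.getLast?, Turn e (q 0)) :
    ∃ p : PathSpace G, p.take l.length = l ∧ ∀ k, p (l.length + k) = q k := by
  induction l with
  | nil => exact ⟨q, rfl, fun k => by simp⟩
  | cons e l ih =>
    obtain ⟨p, hp, hq⟩ := ih hl.tail (by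
      intro f hf
      apply h
      cases l with
      | nil => simp at hf
      | cons a l => simpa [List.getLast?_cons_cons] using hf)
    have ht : Turn e (p 0) := by
      cases l with
      | nil =>
        have h0 := hq 0
        simp only [List.length_nil, add_zero] at h0
        rw [h0]
        exact h e (by simp)
      | cons a l =>
        rw [List.length_cons, take_succ', List.cons.injEq] at hp
        rw [hp.1]
        exact (List.isChain_cons_cons.1 hl).1
    refine ⟨cons e p ht, ?_, fun k => ?_⟩
    · rw [List.length_cons, take_succ', drop_cons, hp]
      rfl
    · rw [List.length_cons, show l.length + 1 + k = (l.length + k) + 1 by omega, cons_succ, hq]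

end PathSpace

open Classical in
/-- The function which sends a path with prefix `l` to the value of `g` at the path that starts
with the last edge of this prefix, and which is zero on all other paths. -/
def shiftCylinder (l : List G.Dart) :
    LocallyConstant (PathSpace G) ℂ →ₗ[ℂ] LocallyConstant (PathSpace G) ℂ where
  toFun g :=
    -- Only `l.length - 1` edges are dropped, so `g` still sees the last edge of `l`. For `l = []`
    -- the truncated subtraction gives back `g` itself.
    { toFun := fun p => if p.take l.length = l then g (p.drop (l.length - 1)) else 0
      isLocallyConstant := by
        rw [PathSpace.isLocallyConstant_iff]
        intro p
        obtain ⟨n, hn⟩ := PathSpace.isLocallyConstant_iff.1 g.isLocallyConstant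
          (p.drop (l.length - 1))
        refine ⟨l.length + n, fun q hq => ?_⟩
        have e : g (q.drop (l.length - 1)) = g (p.drop (l.length - 1)) :=
          hn _ fun i hi => hq _ (by omega)
        rw [PathSpace.take_congr fun i hi => hq i (by omega), e] }
  map_add' f g := by
    ext p
    simp only [LocallyConstant.coe_mk, LocallyConstant.add_apply]
    split_ifs <;> simp
  map_smul' c f := by
    ext p
    simp only [LocallyConstant.coe_mk, LocallyConstant.smul_apply, RingHom.id_apply, smul_eq_mul]
    split_ifs <;> simp

theorem shiftCylinder_of_take {l : List G.Dart} {p : PathSpace G} (h : p.take l.length = l)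
    (g : LocallyConstant (PathSpace G) ℂ) :
    shiftCylinder l g p = g (p.drop (l.length - 1)) :=
  if_pos h

theorem shiftCylinder_of_not {l : List G.Dart} {p : PathSpace G} (h : p.take l.length ≠ l)
    (g : LocallyConstant (PathSpace G) ℂ) : shiftCylinder l g p = 0 :=
  if_neg h

theorem shiftCylinder_singleton (e : G.Dart) (p : PathSpace G) (h : p 0 = e)
    (g : LocallyConstant (PathSpace G) ℂ) : shiftCylinder [e] g p = g p := by
  rw [shiftCylinder_of_take (by simp [PathSpace.take, h])]
  congr 1
  refine PathSpace.ext (funext fun k => ?_)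
  simp

theorem shiftCylinder_singleton_of_ne (e : G.Dart) (p : PathSpace G) (h : p 0 ≠ e)
    (g : LocallyConstant (PathSpace G) ℂ) : shiftCylinder [e] g p = 0 :=
  shiftCylinder_of_not (l := [e]) (by simpa [PathSpace.take] using h) g

theorem sum_locallyConstant_apply {X ι : Type*} [TopologicalSpace X] (s : Finset ι)
    (f : ι → LocallyConstant X ℂ) (p : X) : (∑ i ∈ s, f i) p = ∑ i ∈ s, f i p :=
  map_sum (LocallyConstant.evalₗ ℂ p : LocallyConstant X ℂ →ₗ[ℂ] ℂ) f s

theorem sum_shiftCylinder_singleton [Fintype V] [DecidableRel G.Adj]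
    (f : LocallyConstant (PathSpace G) ℂ) :
    ∑ e : G.Dart, shiftCylinder [e] f = f := by
  classical
  ext p
  rw [sum_locallyConstant_apply, Finset.sum_eq_single (p 0)]
  · exact shiftCylinder_singleton _ _ rfl f
  · exact fun e _ he => shiftCylinder_singleton_of_ne _ _ he.symm f
  · simp

variable [DecidableEq V]

/-- The summand of the transfer operator that belongs to the extension by the edge `e`. -/
def extendBy (e : G.Dart) (f : LocallyConstant (PathSpace G) ℂ) :
    LocallyConstant (PathSpace G) ℂ where
  toFun p := if h : Turn e (p 0) then f (PathSpace.cons e p h) else 0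
  isLocallyConstant := by
    rw [PathSpace.isLocallyConstant_iff]
    intro p
    by_cases h : Turn e (p 0)
    · obtain ⟨n, hn⟩ :=
        PathSpace.isLocallyConstant_iff.1 f.isLocallyConstant (PathSpace.cons e p h)
      refine ⟨n + 1, fun q hq => ?_⟩
      have h' : Turn e (q 0) := by rwa [hq 0 (Nat.succ_pos _)]
      rw [dif_pos h, dif_pos h']
      refine hn _ fun i hi => ?_
      cases i with
      | zero => rfl
      | succ i => exact hq i (by omega)
    · refine ⟨1, fun q hq => ?_⟩
      have h' : ¬ Turn e (q 0) := by rwa [hq 0 Nat.one_pos]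
      rw [dif_neg h, dif_neg h']

theorem extendBy_of_turn {e : G.Dart} {p : PathSpace G} (h : Turn e (p 0))
    (f : LocallyConstant (PathSpace G) ℂ) : extendBy e f p = f (PathSpace.cons e p h) :=
  dif_pos h

theorem extendBy_of_not {e : G.Dart} {p : PathSpace G} (h : ¬ Turn e (p 0))
    (f : LocallyConstant (PathSpace G) ℂ) : extendBy e f p = 0 :=
  dif_neg h

/-- On the cylinder the shifted path begins with `e`, and `d` cannot be put in front of it. This
disposes of the pairs of edges that are not turns in the double sums below. -/
theorem shiftCylinder_extendBy_of_not {l : List G.Dart} {d e : G.Dart} (h : ¬ Turn d e)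
    (g : LocallyConstant (PathSpace G) ℂ) : shiftCylinder (l ++ [e]) (extendBy d g) = 0 := by
  ext p
  by_cases hp : p.take (l ++ [e]).length = l ++ [e]
  · rw [shiftCylinder_of_take hp, extendBy_of_not]
    · rfl
    · rw [List.length_append, List.length_singleton, PathSpace.take_succ] at hp
      have he : p l.length = e := by simpa using (List.append_inj' hp rfl).2
      have e1 : (l ++ [e]).length - 1 = l.length := by simp
      rw [e1, PathSpace.drop_apply, add_zero, he]
      exact h
  · exact shiftCylinder_of_not hp _

variable [Fintype V] [DecidableRel G.Adj]

theorem transfer_eq_sum (f : LocallyConstant (PathSpace G) ℂ) :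
    transfer G f = ∑ e : G.Dart, extendBy e f := by
  ext p
  rw [sum_locallyConstant_apply]
  rfl

/-- Of all one-edge extensions of a path only the one by `e` can lie in the cylinder, so the sum
collapses to one term. A second edge `f` is needed so that the last edge, which `g` sees, survives.
-/
theorem transfer_shiftCylinder {e f : G.Dart} {l : List G.Dart} (h : Turn e f)
    (g : LocallyConstant (PathSpace G) ℂ) :
    transfer G (shiftCylinder (e :: f :: l) g) = shiftCylinder (f :: l) g := by
  ext p
  rw [transfer_eq_sum, sum_locallyConstant_apply]
  have key : ∀ (d : G.Dart) (hd : Turn d (p 0)),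
      (PathSpace.cons d p hd).take (e :: f :: l).length = e :: f :: l ↔
        d = e ∧ p.take (f :: l).length = f :: l := by
    intro d hd
    rw [List.length_cons, PathSpace.take_succ', PathSpace.drop_cons, List.cons.injEq]
    rfl
  rw [Finset.sum_eq_single e]
  · by_cases hp : p.take (f :: l).length = f :: l
    · have h0 : p 0 = f := by
        rw [List.length_cons, PathSpace.take_succ', List.cons.injEq] at hp
        exact hp.1
      have ht : Turn e (p 0) := by rwa [h0]
      rw [extendBy_of_turn ht, shiftCylinder_of_take ((key e ht).2 ⟨rfl, hp⟩),
        shiftCylinder_of_take hp]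
      congr 1
      have e1 : (e :: f :: l).length - 1 = 1 + ((f :: l).length - 1) := by
        simp [add_comm]
      rw [e1, ← PathSpace.drop_drop, PathSpace.drop_cons]
    · rw [shiftCylinder_of_not hp]
      by_cases ht : Turn e (p 0)
      · rw [extendBy_of_turn ht, shiftCylinder_of_not fun h => hp ((key e ht).1 h).2]
      · exact extendBy_of_not ht _
  · intro d _ hd
    by_cases ht : Turn d (p 0)
    · rw [extendBy_of_turn ht, shiftCylinder_of_not fun h => hd ((key d ht).1 h).1]
    · exact extendBy_of_not ht _
  · simp

/-- The cylinder is cut up according to the next edge `e`. Seen from `e`, the edge `d` has been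
dropped, and `extendBy d` puts it back. -/
theorem shiftCylinder_eq_sum (l : List G.Dart) (d : G.Dart)
    (g : LocallyConstant (PathSpace G) ℂ) :
    shiftCylinder (l ++ [d]) g =
      ∑ e : G.Dart, shiftCylinder (l ++ [d] ++ [e]) (extendBy d g) := by
  ext p
  rw [sum_locallyConstant_apply]
  have hlen : (l ++ [d]).length = l.length + 1 := by simp
  have key : ∀ e : G.Dart, p.take (l ++ [d] ++ [e]).length = l ++ [d] ++ [e] ↔
      p.take (l ++ [d]).length = l ++ [d] ∧ p (l ++ [d]).length = e := by
    intro e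
    rw [List.length_append, List.length_singleton, PathSpace.take_succ]
    constructor
    · intro h
      have := List.append_inj' h rfl
      exact ⟨this.1, by simpa using this.2⟩
    · rintro ⟨h1, h2⟩
      rw [h1, h2]
  by_cases hp : p.take (l ++ [d]).length = l ++ [d]
  · rw [Finset.sum_eq_single (p (l ++ [d]).length)]
    · rw [shiftCylinder_of_take hp, shiftCylinder_of_take ((key _).2 ⟨hp, rfl⟩)]
      have hd : p l.length = d := by
        rw [hlen, PathSpace.take_succ] at hp
        simpa using (List.append_inj' hp rfl).2
      have ht : Turn (p l.length) (p.drop (l.length + 1) 0) := p.turn l.length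
      have e1 : (l ++ [d] ++ [p (l ++ [d]).length]).length - 1 = l.length + 1 := by simp
      have e2 : (l ++ [d]).length - 1 = l.length := by simp
      rw [e1, e2, ← hd, extendBy_of_turn ht, PathSpace.cons_drop]
    · exact fun e _ he => shiftCylinder_of_not (fun h => he ((key e).1 h).2.symm) _
    · simp
  · rw [shiftCylinder_of_not hp, Finset.sum_eq_zero]
    exact fun e _ => shiftCylinder_of_not (fun h => hp ((key e).1 h).1) _

end Cylinders

/-! ### Every oriented edge can be reached without backtracking -/

section Reachability

variable {V : Type u} [Fintype V] [DecidableEq V] {G : SimpleGraph V} [DecidableRel G.Adj]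

/-- An edge of `R` entering `v` can be followed by every edge leaving `v` except its own opposite.
Two distinct entering edges thus put all edges leaving `v` into `R`; a single one puts in all but
one, which is at least one because the degree is at least 2. -/
theorem card_darts_to_le_card_darts_from (hdeg : ∀ v, 2 ≤ G.degree v) {R : Finset G.Dart}
    (hR : ∀ e ∈ R, ∀ f, Turn e f → f ∈ R) (v : V) :
    (R.filter fun e => e.snd = v).card ≤ (R.filter fun e => e.fst = v).card := by
  have hout : (Finset.univ.filter fun e : G.Dart => e.fst = v).card = G.degree v :=
    G.dart_fst_fiber_card_eq_degree v
  have hin : (R.filter fun e => e.snd = v).card ≤ G.degree v := by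
    rw [← hout]
    refine Finset.card_le_card_of_injOn SimpleGraph.Dart.symm (fun e he => ?_)
      (SimpleGraph.Dart.symm_involutive.injective.injOn)
    have := (Finset.mem_filter.1 he).2
    exact Finset.mem_coe.2 (Finset.mem_filter.2 ⟨Finset.mem_univ _, this⟩)
  have mem : ∀ e ∈ R.filter (fun e => e.snd = v), ∀ f : G.Dart, f.fst = v → f ≠ e.symm →
      f ∈ R.filter (fun e => e.fst = v) := by
    intro e he f hf hne
    obtain ⟨he, hev⟩ := Finset.mem_filter.1 he
    refine Finset.mem_filter.2 ⟨hR e he f ⟨hev.trans hf.symm, fun h => hne ?_⟩, hf⟩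
    rw [h, SimpleGraph.Dart.symm_symm]
  rcases (R.filter fun e => e.snd = v).eq_empty_or_nonempty with h | ⟨e, he⟩
  · simp [h]
  · by_cases h1 : ∃ e' ∈ R.filter (fun e => e.snd = v), e' ≠ e
    · obtain ⟨e', he', hne⟩ := h1
      refine hin.trans (hout.symm.le.trans (Finset.card_le_card fun f hf => ?_))
      have hf := (Finset.mem_filter.1 hf).2
      by_cases hfe : f = e.symm
      · refine mem e' he' f hf fun h => hne ?_
        exact SimpleGraph.Dart.symm_involutive.injective (h.symm.trans hfe)
      · exact mem e he f hf hfe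
    · push Not at h1
      have h2 : (R.filter fun e => e.snd = v).card ≤ 1 :=
        Finset.card_le_one.2 fun a ha b hb => (h1 a ha).trans (h1 b hb).symm
      have h3 : ((Finset.univ.filter fun e : G.Dart => e.fst = v).erase e.symm).card ≤
          (R.filter fun e => e.fst = v).card :=
        Finset.card_le_card fun f hf =>
          mem e he f (Finset.mem_filter.1 (Finset.mem_of_mem_erase hf)).2 (Finset.ne_of_mem_erase hf)
      have h4 := Finset.pred_card_le_card_erase
        (s := Finset.univ.filter fun e : G.Dart => e.fst = v) (a := e.symm)
      have := hdeg v
      omega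

/-- A set of oriented edges that is closed under turns and contains all edges issuing from some
vertex contains every oriented edge. -/
theorem mem_of_turn_closed (hconn : G.Connected) (hdeg : ∀ v, 2 ≤ G.degree v)
    {R : Finset G.Dart} (hR : ∀ e ∈ R, ∀ f, Turn e f → f ∈ R) {x : V}
    (hx : ∀ e : G.Dart, e.fst = x → e ∈ R) (e : G.Dart) : e ∈ R := by
  -- Summed over all `v`, both sides of the inequality count `R`, so equality holds at every vertex.
  have hbal : ∀ v, (R.filter fun e => e.snd = v).card = (R.filter fun e => e.fst = v).card := by
    have h := (Finset.sum_eq_sum_iff_of_le (s := Finset.univ)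
      fun v _ => card_darts_to_le_card_darts_from hdeg hR v).1 (by
        rw [← Finset.card_eq_sum_card_fiberwise fun _ _ => Finset.mem_coe.2 (Finset.mem_univ _),
          ← Finset.card_eq_sum_card_fiberwise fun _ _ => Finset.mem_coe.2 (Finset.mem_univ _)])
    exact fun v => h v (Finset.mem_univ v)
  -- If all edges leaving `v` are in `R`, balance forces as many entering edges into `R`, hence all
  -- of them.
  have hfull : ∀ v, (∀ e : G.Dart, e.fst = v → e ∈ R) → ∀ e : G.Dart, e.snd = v → e ∈ R := by
    intro v hv e he
    have h1 : (R.filter fun e => e.snd = v).image SimpleGraph.Dart.symm =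
        R.filter fun e => e.fst = v := by
      refine Finset.eq_of_subset_of_card_le (fun f hf => ?_) ?_
      · obtain ⟨d, hd, rfl⟩ := Finset.mem_image.1 hf
        have := (Finset.mem_filter.1 hd).2
        exact Finset.mem_filter.2 ⟨hv _ this, this⟩
      · rw [Finset.card_image_of_injective _ SimpleGraph.Dart.symm_involutive.injective, hbal]
    have h2 : e.symm ∈ R.filter fun e => e.fst = v := Finset.mem_filter.2 ⟨hv _ he, he⟩
    rw [← h1] at h2
    obtain ⟨d, hd, hde⟩ := Finset.mem_image.1 h2
    rw [← SimpleGraph.Dart.symm_involutive.injective hde]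
    exact (Finset.mem_filter.1 hd).1
  -- An edge leaving `w` either continues the edge from `v` to `w` without backtracking, or returns
  -- to `v` and is covered by `hfull`.
  have step : ∀ v w, G.Adj v w → (∀ e : G.Dart, e.fst = v → e ∈ R) →
      ∀ e : G.Dart, e.fst = w → e ∈ R := by
    intro v w hvw hv f hf
    by_cases h : f.snd = v
    · exact hfull v hv f h
    · refine hR ⟨(v, w), hvw⟩ (hv _ rfl) f ⟨hf.symm, fun h' => h ?_⟩
      exact (congrArg (fun d : G.Dart => d.fst) h').symm
  obtain ⟨p⟩ := hconn.preconnected x e.fst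
  have walk : ∀ {v w : V} (_ : G.Walk v w), (∀ e : G.Dart, e.fst = v → e ∈ R) →
      ∀ e : G.Dart, e.fst = w → e ∈ R := by
    intro v w p
    induction p with
    | nil => exact id
    | cons h _ ih => exact fun hv => ih (step _ _ h hv)
  exact walk p hx e rfl

end Reachability

open CoverVertex

/-! ### Lifting edges to the universal cover; deck transformations -/

section Deck

variable {V : Type u} {G : SimpleGraph V} {x : V}

namespace CoverVertex

theorem coverProj_of_edges {c d : CoverVertex G x} {e : G.Dart} (h : d.edges = c.edges ++ [e]) :
    coverProj d = e.snd := by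
  simp [coverProj, h]

theorem fst_eq_coverProj {c d : CoverVertex G x} {e : G.Dart} (h : d.edges = c.edges ++ [e]) :
    e.fst = coverProj c := by
  rcases List.eq_nil_or_concat c.edges with hc | ⟨l, f, hc⟩
  · rw [coverProj, hc]
    exact d.head e (by simp [h, hc])
  · rw [List.concat_eq_append] at hc
    have := d.chain
    rw [h, hc, List.isChain_append] at this
    have ht : Turn f e := this.2.2 f (by simp) e (by simp)
    simp [coverProj, hc, ht.1]

theorem turn_of_edges {c d : CoverVertex G x} {e f : G.Dart} (h : d.edges = c.edges ++ [e])
    (hf : c.edges.getLast? = some f) : Turn f e := by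
  have := d.chain
  rw [h, List.isChain_append] at this
  exact this.2.2 f hf e (by simp)

theorem exists_getLast {d : CoverVertex G x} (h : d.edges ≠ []) :
    ∃ e, d.edges.getLast? = some e :=
  ⟨_, List.getLast?_eq_some_getLast h⟩

theorem exists_edges_eq {d : CoverVertex G x} {e : G.Dart} (h : d.edges.getLast? = some e) :
    ∃ c : CoverVertex G x, d.edges = c.edges ++ [e] := by
  obtain ⟨l, hl⟩ := List.getLast?_eq_some_iff.1 h
  have h1 := d.chain
  rw [hl, List.isChain_append] at h1
  refine ⟨⟨l, h1.1, fun f hf => d.head f ?_⟩, hl⟩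
  rw [hl]
  cases l with
  | nil => simp at hf
  | cons a l => simpa using hf

theorem exists_snoc (c : CoverVertex G x) (e : G.Dart) (h : e.fst = coverProj c)
    (hne : c.edges.getLast? ≠ some e.symm) : ∃ d : CoverVertex G x, d.edges = c.edges ++ [e] := by
  refine ⟨⟨c.edges ++ [e], ?_, ?_⟩, rfl⟩
  · rw [List.isChain_append]
    refine ⟨c.chain, by simp, fun f hf g hg => ?_⟩
    have hg : e = g := by simpa using hg
    subst hg
    have hf' : c.edges.getLast? = some f := hf
    refine ⟨?_, fun h' => hne (h' ▸ hf')⟩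
    rw [h, coverProj, hf']
    rfl
  · intro f hf
    rcases hc : c.edges with _ | ⟨a, l⟩
    · rw [hc] at hf
      have hf : e = f := by simpa using hf
      rw [← hf, h, coverProj, hc]
      rfl
    · rw [hc] at hf
      exact c.head f (by rw [hc]; simpa using hf)

open Classical in
/-- The end point of the lift of the edge `e` to the universal cover that starts at `c`,
provided that `e` starts at the projection of `c`. -/
def step (c : CoverVertex G x) (e : G.Dart) : CoverVertex G x :=
  -- An edge that reverses the last edge of `c` is lifted by deleting that last edge; any other edge
  -- starting at the projection of `c` is appended. The final branch is a default value.
  if h : c.edges.getLast? = some e.symm then (exists_edges_eq h).choose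
  else if h' : e.fst = coverProj c then (exists_snoc c e h' h).choose
  else c

theorem step_of_edges {c d : CoverVertex G x} {e : G.Dart} (h : d.edges = c.edges ++ [e]) :
    step c e = d := by
  have h1 : c.edges.getLast? ≠ some e.symm := fun h' =>
    (turn_of_edges h h').2 rfl
  have h2 := fst_eq_coverProj h
  rw [step, dif_neg h1, dif_pos h2]
  exact CoverVertex.ext ((exists_snoc c e h2 h1).choose_spec.trans h.symm)

theorem step_of_edges_symm {c d : CoverVertex G x} {e : G.Dart}
    (h : c.edges = d.edges ++ [e.symm]) : step c e = d := by
  have h1 : c.edges.getLast? = some e.symm := by simp [h]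
  rw [step, dif_pos h1]
  exact CoverVertex.ext (List.append_inj' ((exists_edges_eq h1).choose_spec.symm.trans h) rfl).1

theorem step_cases (c : CoverVertex G x) (e : G.Dart) (h : e.fst = coverProj c) :
    c.edges = (step c e).edges ++ [e.symm] ∨ (step c e).edges = c.edges ++ [e] := by
  by_cases h1 : c.edges.getLast? = some e.symm
  · obtain ⟨d, hd⟩ := exists_edges_eq h1
    rw [step_of_edges_symm hd]
    exact Or.inl hd
  · obtain ⟨d, hd⟩ := exists_snoc c e h h1
    rw [step_of_edges hd]
    exact Or.inr hd

theorem coverProj_step {c : CoverVertex G x} {e : G.Dart} (h : e.fst = coverProj c) :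
    coverProj (step c e) = e.snd := by
  rcases step_cases c e h with h1 | h1
  · exact (fst_eq_coverProj h1).symm
  · exact coverProj_of_edges h1

theorem step_step_symm {c : CoverVertex G x} {e : G.Dart} (h : e.fst = coverProj c) :
    step (step c e) e.symm = c := by
  rcases step_cases c e h with h1 | h1
  · exact step_of_edges h1
  · exact step_of_edges_symm h1

theorem adj_step {c : CoverVertex G x} {e : G.Dart} (h : e.fst = coverProj c) :
    (universalCover G x).Adj c (step c e) := by
  rcases step_cases c e h with h1 | h1
  · exact Or.inr ⟨_, h1⟩
  · exact Or.inl ⟨_, h1⟩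

theorem exists_step_of_adj {c d : CoverVertex G x} (h : (universalCover G x).Adj c d) :
    ∃ e : G.Dart, e.fst = coverProj c ∧ step c e = d := by
  rcases h with ⟨e, h⟩ | ⟨e, h⟩
  · exact ⟨e, fst_eq_coverProj h, step_of_edges h⟩
  · exact ⟨e.symm, (coverProj_of_edges h).symm, step_of_edges_symm h⟩

@[elab_as_elim]
theorem induction_snoc {motive : CoverVertex G x → Prop} (base : motive (coverBase G x))
    (snoc : ∀ (c d : CoverVertex G x) (e : G.Dart), d.edges = c.edges ++ [e] → motive c → motive d)
    (c : CoverVertex G x) : motive c := by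
  suffices h : ∀ (n : ℕ) (c : CoverVertex G x), c.edges.length = n → motive c from h _ c rfl
  intro n
  induction n with
  | zero =>
    intro c hc
    have : c = coverBase G x := CoverVertex.ext (List.length_eq_zero_iff.1 hc)
    rwa [this]
  | succ n ih =>
    intro d hd
    obtain ⟨e, he⟩ := exists_getLast (d := d) (by rintro h; simp [h] at hd)
    obtain ⟨c, hc⟩ := exists_edges_eq he
    exact snoc c d e hc (ih c (by simpa [hc] using hd))

/-- The lift of a path in `G`, given by its lift starting at the base vertex, to the vertex `s`
of the universal cover. -/
def translate (s c : CoverVertex G x) : CoverVertex G x := c.edges.foldl step s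

@[simp] theorem translate_base (s : CoverVertex G x) : translate s (coverBase G x) = s := rfl

theorem translate_of_edges (s : CoverVertex G x) {c d : CoverVertex G x} {e : G.Dart}
    (h : d.edges = c.edges ++ [e]) : translate s d = step (translate s c) e := by
  simp [translate, h]

theorem coverProj_translate {s : CoverVertex G x} (hs : coverProj s = x) (c : CoverVertex G x) :
    coverProj (translate s c) = coverProj c := by
  induction c using induction_snoc with
  | base => exact hs
  | snoc c d e h ih =>
    rw [translate_of_edges s h, coverProj_step (by rw [ih, fst_eq_coverProj h]),
      coverProj_of_edges h]

/-- Folding gives this at once when the step appends an edge. When it deletes one, the identity for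
the opposite step is reversed by `step_step_symm`. -/
theorem translate_step {s : CoverVertex G x} (hs : coverProj s = x) {c : CoverVertex G x}
    {e : G.Dart} (h : e.fst = coverProj c) : translate s (step c e) = step (translate s c) e := by
  rcases step_cases c e h with h1 | h1
  · have h2 := translate_of_edges s h1
    have h3 : e.symm.fst = coverProj (translate s (step c e)) := by
      rw [coverProj_translate hs, coverProj_step h]
      rfl
    have := step_step_symm h3
    rw [← h2, SimpleGraph.Dart.symm_symm] at this
    exact this.symm
  · exact translate_of_edges s h1

theorem translate_adj {s : CoverVertex G x} (hs : coverProj s = x) {c d : CoverVertex G x}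
    (h : (universalCover G x).Adj c d) :
    (universalCover G x).Adj (translate s c) (translate s d) := by
  obtain ⟨e, he, rfl⟩ := exists_step_of_adj h
  rw [translate_step hs he]
  exact adj_step (by rw [coverProj_translate hs, he])

/-- The image contains `s` and is closed under passing to neighbours, since edges lift through
`translate_step`; the tree is connected. -/
theorem translate_surjective {s : CoverVertex G x} (hs : coverProj s = x) :
    Function.Surjective (translate s) := by
  have walk : ∀ {c d : CoverVertex G x} (_ : (universalCover G x).Walk c d),
      (∃ a, translate s a = c) → ∃ a, translate s a = d := by
    intro c d p
    induction p with
    | nil => exact id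
    | cons h _ ih =>
      rintro ⟨a, rfl⟩
      obtain ⟨e, he, rfl⟩ := exists_step_of_adj h
      refine ih ⟨step a e, translate_step hs ?_⟩
      rw [he, coverProj_translate hs]
  intro d
  obtain ⟨p⟩ := (universalCover_isTree G x).connected.preconnected s d
  exact walk p ⟨coverBase G x, rfl⟩

theorem translate_translate {s : CoverVertex G x} (hs : coverProj s = x) {t : CoverVertex G x}
    (ht : coverProj t = x) (c : CoverVertex G x) :
    translate s (translate t c) = translate (translate s t) c := by
  induction c using induction_snoc with
  | base => rfl
  | snoc c d e h ih =>
    rw [translate_of_edges t h, translate_of_edges _ h, ← ih, translate_step hs]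
    rw [coverProj_translate ht, fst_eq_coverProj h]

@[simp] theorem base_translate (c : CoverVertex G x) : translate (coverBase G x) c = c := by
  induction c using induction_snoc with
  | base => rfl
  | snoc c d e h ih => rw [translate_of_edges _ h, ih, step_of_edges h]

/-- A preimage of the base vertex gives a right inverse. That right inverse has a right inverse of
its own, which must be the original map, so the inverse is two-sided. -/
theorem exists_translate_inverse {s : CoverVertex G x} (hs : coverProj s = x) :
    ∃ t : CoverVertex G x, coverProj t = x ∧ (∀ c, translate s (translate t c) = c) ∧
      ∀ c, translate t (translate s c) = c := by
  have right : ∀ {s : CoverVertex G x}, coverProj s = x → ∃ t : CoverVertex G x,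
      coverProj t = x ∧ ∀ c, translate s (translate t c) = c := by
    intro s hs
    obtain ⟨t, ht⟩ := translate_surjective hs (coverBase G x)
    have hx : coverProj t = x := by
      rw [← coverProj_translate hs, ht]
      rfl
    exact ⟨t, hx, fun c => by rw [translate_translate hs hx, ht, base_translate]⟩
  obtain ⟨t, ht, h1⟩ := right hs
  obtain ⟨u, -, h2⟩ := right ht
  refine ⟨t, ht, h1, fun c => ?_⟩
  have : translate u c = translate s c := by
    rw [← h1 (translate u c), h2]
  rw [← this, h2]

end CoverVertex

/-- The deck transformations act transitively on the fibres of the covering projection. -/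
theorem exists_deck (a b : CoverVertex G x) (hab : coverProj a = coverProj b) :
    ∃ γ ∈ deckGroup G x, γ a = b := by
  -- To move a path ending in `e` to `b`, it suffices to move its prefix without `e` to the
  -- neighbour `step b e.symm` of `b`.
  obtain ⟨s, hs, hsa⟩ : ∃ s : CoverVertex G x, coverProj s = x ∧ translate s a = b := by
    induction a using induction_snoc generalizing b with
    | base => exact ⟨b, hab.symm, rfl⟩
    | snoc c d e h ih =>
      rw [coverProj_of_edges h] at hab
      have hab' : e.symm.fst = coverProj b := hab
      obtain ⟨s, hs, hsc⟩ := ih (step b e.symm) (by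
        rw [coverProj_step hab', ← fst_eq_coverProj h]
        rfl)
      refine ⟨s, hs, ?_⟩
      rw [translate_of_edges s h, hsc]
      exact step_step_symm hab'
  obtain ⟨t, ht, h1, h2⟩ := exists_translate_inverse hs
  refine ⟨⟨⟨translate s, translate t, h2, h1⟩, ?_⟩, coverProj_translate hs, hsa⟩
  intro c d
  refine ⟨fun h => ?_, translate_adj hs⟩
  have := translate_adj ht h
  rwa [Equiv.coe_fn_mk, h2, h2] at this

/-- A deck transformation preserves adjacency and projections, and in a simple graph an edge is
determined by its end points. -/
theorem deck_step {γ : universalCover G x ≃g universalCover G x} (hγ : γ ∈ deckGroup G x)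
    {c : CoverVertex G x} {e : G.Dart} (h : e.fst = coverProj c) :
    γ (step c e) = step (γ c) e := by
  obtain ⟨e', he', h'⟩ := exists_step_of_adj (γ.map_adj_iff.2 (adj_step h))
  have h2 : e'.snd = e.snd := by
    rw [← coverProj_step he', h', hγ, coverProj_step h]
  have h1 : e'.fst = e.fst := by rw [he', hγ, h]
  rw [← h', show e' = e from SimpleGraph.Dart.ext _ _ (Prod.ext h1 h2)]

/-- Walking from the base vertex to `a`, the image walk starts at the image of the base vertex. It
first cancels edges there, and once it has appended an edge it never cancels again. A walk longer
than that starting path must have begun to append. -/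
theorem deck_getLast {γ : universalCover G x ≃g universalCover G x} (hγ : γ ∈ deckGroup G x)
    (a : CoverVertex G x) (ha : (γ (coverBase G x)).edges.length < a.edges.length) :
    (γ a).edges.getLast? = a.edges.getLast? := by
  -- The second alternative says that every edge so far was used for cancellation.
  suffices h : (a.edges ≠ [] ∧ (γ a).edges.getLast? = a.edges.getLast?) ∨
      (γ a).edges.length + a.edges.length = (γ (coverBase G x)).edges.length by
    rcases h with h | h
    · exact h.2
    · omega
  clear ha
  induction a using induction_snoc with
  | base => exact Or.inr rfl
  | snoc c d e h ih =>
    have he := fst_eq_coverProj h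
    have hd : γ d = step (γ c) e := by rw [← deck_step hγ he, step_of_edges h]
    rcases step_cases (γ c) e (by rw [hγ, he]) with h1 | h1
    · rw [← hd] at h1
      rcases ih with ⟨h2, h3⟩ | h2
      -- A cancellation after the last edges have come to agree would make `e` backtrack already in
      -- `d`.
      · exfalso
        refine (turn_of_edges h (f := e.symm) ?_).2 rfl
        rw [← h3, h1]
        simp
      · right
        rw [h1] at h2
        rw [h]
        simp only [List.length_append, List.length_singleton] at h2 ⊢
        omega
    · rw [← hd] at h1
      left
      simp [h1, h]

/-- Every oriented edge is the last edge of a path without backtracking from the base vertex. -/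
theorem exists_coverVertex_getLast [Fintype V] [DecidableEq V] [DecidableRel G.Adj]
    (hconn : G.Connected) (hdeg : ∀ v, 2 ≤ G.degree v) (e : G.Dart) :
    ∃ c : CoverVertex G x, c.edges.getLast? = some e := by
  classical
  have h := mem_of_turn_closed hconn hdeg (x := x)
    (R := Finset.univ.filter fun e => ∃ c : CoverVertex G x, c.edges.getLast? = some e) ?_ ?_ e
  · exact (Finset.mem_filter.1 h).2
  · intro e he f hf
    obtain ⟨c, hc⟩ := (Finset.mem_filter.1 he).2
    obtain ⟨d, hd⟩ := exists_snoc c f (by rw [coverProj, hc]; exact hf.1.symm) (by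
      rw [hc]
      exact fun h => hf.2 (Option.some.inj h))
    exact Finset.mem_filter.2 ⟨Finset.mem_univ _, d, by simp [hd]⟩
  · intro e he
    refine Finset.mem_filter.2 ⟨Finset.mem_univ _, ⟨[e], by simp, by simpa using he⟩, by simp⟩

end Deck

/-! ### The island as boundary; conformality and twisted invariance -/

section Boundary

variable {V : Type u} {G : SimpleGraph V} {x : V}

theorem pathPrefix_eq_iff {p : Island G x} {a : CoverVertex G x} :
    pathPrefix p a.edges.length = a ↔ p.1.take a.edges.length = a.edges :=
  CoverVertex.ext_iff

/-- Each step of the ray lengthens the finite path: the empty path cannot be shortened, and a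
shortening after a lengthening would return to the previous vertex, which is backtracking. -/
theorem exists_liftPath_eq (r : PathSpace (universalCover G x)) (h : r.start = coverBase G x) :
    ∃ p : Island G x, liftPath p = r := by
  have key : ∀ n, ∃ e, (r n).snd.edges = (r n).fst.edges ++ [e] := by
    intro n
    induction n with
    | zero =>
      rcases (r 0).adj with h1 | ⟨e, h1⟩
      · exact h1
      · have h2 : (r 0).fst.edges = [] := congrArg CoverVertex.edges h
        rw [h2] at h1
        simp at h1
    | succ n ih =>
      obtain ⟨t1, t2⟩ := r.turn n
      rcases (r (n + 1)).adj with h1 | ⟨e, h1⟩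
      · exact h1
      · exfalso
        obtain ⟨f, hf⟩ := ih
        have h1' : (r (n + 1)).fst.edges = (r (n + 1)).snd.edges ++ [e] := h1
        rw [t1, h1'] at hf
        have h3 : (r (n + 1)).snd = (r n).fst := CoverVertex.ext (List.append_inj' hf rfl).1
        exact t2 (SimpleGraph.Dart.ext _ _ (Prod.ext h3.symm t1))
  choose q hq using key
  have hturn : ∀ n, Turn (q n) (q (n + 1)) := by
    intro n
    refine turn_of_edges (hq (n + 1)) ?_
    rw [← (r.turn n).1, hq n]
    simp
  have hstart : (q 0).fst = x := by
    have h1 : (r 0).fst = coverBase G x := h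
    rw [fst_eq_coverProj (hq 0), h1]
    rfl
  refine ⟨⟨⟨q, hturn⟩, hstart⟩, ?_⟩
  have hpre : ∀ n, pathPrefix (⟨⟨q, hturn⟩, hstart⟩ : Island G x) n = (r n).fst := by
    intro n
    induction n with
    | zero => exact h.symm
    | succ n ih =>
      refine CoverVertex.ext ?_
      rw [pathPrefix_succ, ih, ← (r.turn n).1, hq n]
  refine PathSpace.ext (funext fun n => SimpleGraph.Dart.ext _ _ (Prod.ext (hpre n) ?_))
  exact (hpre (n + 1)).trans (r.turn n).1.symm

theorem eq_of_pathPrefix_eq {p q : Island G x} {n : ℕ} (h : pathPrefix p n = pathPrefix q n)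
    {i : ℕ} (hi : i < n) : p.1 i = q.1 i :=
  List.map_inj_left.1 (congrArg CoverVertex.edges h) i (List.mem_range.2 hi)

theorem islandToBoundary_bijective :
    Function.Bijective (islandToBoundary : Island G x → CoverBoundary G x) := by
  constructor
  · intro p q h
    have h1 : liftPath p = liftPath q :=
      ray_unique (universalCover_isTree G x) (r := liftPath p) (s := liftPath q) rfl h
    refine Subtype.ext (PathSpace.ext (funext fun n => ?_))
    refine eq_of_pathPrefix_eq (n := n + 1) ?_ (Nat.lt_succ_self n)
    exact congrArg (fun r : PathSpace (universalCover G x) => (r n).snd) h1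
  · intro ω
    obtain ⟨r, hr, rfl⟩ := exists_rayTo _ (coverBase G x) ω
    obtain ⟨p, rfl⟩ := exists_liftPath_eq r hr
    exact ⟨p, rfl⟩

/-- The ends beyond the `n`-th edge of the lifted ray all come from paths that share the first `n`
edges. -/
theorem islandToBoundary_isOpenMap :
    IsOpenMap (islandToBoundary : Island G x → CoverBoundary G x) := by
  intro U hU
  rw [isOpen_iff_forall_mem_open]
  rintro _ ⟨p, hp, rfl⟩
  obtain ⟨U', hU', rfl⟩ := isOpen_induced_iff.1 hU
  obtain ⟨n, hn⟩ := PathSpace.isOpen_iff.1 hU' p.1 hp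
  refine ⟨Boundary.forward _ (liftPath p n), ?_, Boundary.isOpen_forward _ _,
    (liftPath p).drop n, rfl, (Boundary.mk_eq _).2 ⟨0, n, fun k => by simp⟩⟩
  rintro _ ⟨s, hs, rfl⟩
  obtain ⟨q, hq⟩ := exists_liftPath_eq ((liftPath p).splice s n hs.symm)
    (PathSpace.splice_start _ _ _ _)
  refine ⟨q, hn _ fun i hi => (eq_of_pathPrefix_eq ?_ hi : q.1 i = p.1 i), ?_⟩
  · have h1 : liftPath q n = liftPath p n := by
      rw [hq]
      exact (PathSpace.splice_add _ s n hs.symm 0).trans hs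
    exact congrArg (fun d : (universalCover G x).Dart => d.fst) h1
  · refine (Boundary.mk_eq _).2 ⟨n, 0, fun k => ?_⟩
    rw [hq, PathSpace.splice_add, zero_add]

variable (G x) in
/-- The identification of the island of the base vertex with the boundary of the universal cover
is a homeomorphism. -/
def islandHomeo : Island G x ≃ₜ CoverBoundary G x :=
  (Equiv.ofBijective _ islandToBoundary_bijective).toHomeomorphOfContinuousOpen
    islandToBoundary.continuous islandToBoundary_isOpenMap

theorem deck_pathPrefix
    {γ : universalCover G x ≃g universalCover G x} (hγ : γ ∈ deckGroup G x)
    {p q : Island G x} {m n : ℕ} (h0 : γ (pathPrefix p n) = pathPrefix q m)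
    (h : ∀ k, p.1 (n + k) = q.1 (m + k)) (k : ℕ) :
    γ (pathPrefix p (n + k)) = pathPrefix q (m + k) := by
  induction k with
  | zero => exact h0
  | succ k ih =>
    have h1 := pathPrefix_succ p (n + k)
    rw [← add_assoc, ← add_assoc, ← step_of_edges h1, deck_step hγ (fst_eq_coverProj h1), ih, h k]
    exact step_of_edges (pathPrefix_succ q (m + k))

theorem aut_islandHomeo
    {γ : universalCover G x ≃g universalCover G x} (hγ : γ ∈ deckGroup G x)
    {p q : Island G x} {m n : ℕ} (h0 : γ (pathPrefix p n) = pathPrefix q m)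
    (h : ∀ k, p.1 (n + k) = q.1 (m + k)) :
    Boundary.aut _ γ (islandHomeo G x p) = islandHomeo G x q := by
  refine (Boundary.mk_eq _).2 ⟨n, m, fun k => ?_⟩
  refine SimpleGraph.Dart.ext _ _ (Prod.ext (deck_pathPrefix hγ h0 h k) ?_)
  exact deck_pathPrefix hγ h0 h (k + 1)

/-- The vertex `γ (pathPrefix p n) = pathPrefix q m` lies on both rays, at distance `n` from the
image of the base vertex and `m` from the base vertex. -/
theorem horoDist_aut_islandHomeo
    {γ : universalCover G x ≃g universalCover G x} (hγ : γ ∈ deckGroup G x)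
    {p q : Island G x} {m n : ℕ} (h0 : γ (pathPrefix p n) = pathPrefix q m)
    (h : ∀ k, p.1 (n + k) = q.1 (m + k)) :
    horoDist (universalCover_isTree G x) (Boundary.aut _ γ (islandHomeo G x p))
      (γ (coverBase G x)) (coverBase G x) = (n : ℤ) - m := by
  have e1 : rayTo (universalCover_isTree G x) (γ (coverBase G x))
      (Boundary.aut _ γ (islandHomeo G x p)) = PathSpace.map γ (liftPath p) :=
    eq_rayTo _ rfl rfl
  have e2 : rayTo (universalCover_isTree G x) (coverBase G x)
      (Boundary.aut _ γ (islandHomeo G x p)) = liftPath q :=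
    eq_rayTo _ rfl (aut_islandHomeo hγ h0 h).symm
  refine horoDist_eq _ _ _ _ n m ?_
  rw [e1, e2]
  exact h0

theorem aut_inv_aut {W : Type u} {T : SimpleGraph W} (hT : T.IsTree) (γ : T ≃g T)
    (ω : Boundary hT) : Boundary.aut hT γ⁻¹ (Boundary.aut hT γ ω) = ω := by
  obtain ⟨r, rfl⟩ := Quotient.exists_rep ω
  refine (Boundary.mk_eq hT).2 ⟨0, 0, fun k => ?_⟩
  exact SimpleGraph.Dart.ext _ _
    (Prod.ext (RelIso.inv_apply_self γ _) (RelIso.inv_apply_self γ _))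

/-- Whether a tail may follow a finite path depends only on the last edge of that path, so the tail
of `p` also fits behind `b`. -/
theorem exists_island_shift {a b : CoverVertex G x} {e : G.Dart}
    (ha : a.edges.getLast? = some e) (hb : b.edges.getLast? = some e) {p : Island G x}
    (hp : p.1.take a.edges.length = a.edges) :
    ∃ q : Island G x, q.1.take b.edges.length = b.edges ∧
      ∀ k, p.1 (a.edges.length + k) = q.1 (b.edges.length + k) := by
  obtain ⟨c, hc⟩ := exists_edges_eq ha
  have hturn : Turn e (p.1 a.edges.length) := by
    have hl : a.edges.length = c.edges.length + 1 := by simp [hc]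
    rw [hl, PathSpace.take_succ, hc] at hp
    have : p.1 c.edges.length = e := by simpa using (List.append_inj' hp rfl).2
    rw [hl, ← this]
    exact p.1.turn _
  obtain ⟨q, hq, hqp⟩ := PathSpace.exists_take_drop b.chain (p.1.drop a.edges.length) (by
    intro f hf
    have hf' : b.edges.getLast? = some f := hf
    rw [hb] at hf'
    rw [← Option.some.inj hf']
    exact hturn)
  refine ⟨⟨q, PathSpace.start_eq_of_take ?_ b.head hq⟩, hq, fun k => (hqp k).symm⟩
  rintro h
  simp [h] at hb

variable (G x) in
/-- Restriction of locally constant functions to an island. -/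
def toIsland : LocallyConstant (PathSpace G) ℂ →ₗ[ℂ] LocallyConstant (Island G x) ℂ :=
  LocallyConstant.comapₗ ℂ ⟨Subtype.val, continuous_subtype_val⟩

@[simp] theorem toIsland_apply (f : LocallyConstant (PathSpace G) ℂ) (p : Island G x) :
    toIsland G x f p = f p.1 := rfl

theorem toIsland_extendByZero (f : LocallyConstant (Island G x) ℂ) :
    toIsland G x (extendByZero G x f) = f := by
  ext p
  exact dif_pos p.2

variable (G x) in
/-- Transport of locally constant functions from an island to the boundary. -/
def toBoundary : LocallyConstant (Island G x) ℂ →ₗ[ℂ] LocallyConstant (CoverBoundary G x) ℂ :=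
  LocallyConstant.comapₗ ℂ ⟨(islandHomeo G x).symm, (islandHomeo G x).symm.continuous⟩

theorem toBoundary_comap (f : LocallyConstant (CoverBoundary G x) ℂ) :
    toBoundary G x (LocallyConstant.comapₗ ℂ islandToBoundary f) = f := by
  ext ω
  exact congrArg f ((islandHomeo G x).apply_symm_apply ω)

theorem map_islandToBoundary_apply (ν : FinAddMeasure (Island G x))
    (f : LocallyConstant (Island G x) ℂ) :
    FinAddMeasure.map islandToBoundary ν (toBoundary G x f) = ν f := by
  refine congrArg ν ?_
  ext p
  exact congrArg f ((islandHomeo G x).symm_apply_apply p)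

/-- A measure on an island is `z`-conformal if the masses of the districts whose prefixes have a
common last edge are in the proportion prescribed by the powers of `z`. -/
def IsConformal (z : ℂ) (ν : FinAddMeasure (Island G x)) : Prop :=
  ∀ (a b : CoverVertex G x) (e : G.Dart), a.edges.getLast? = some e → b.edges.getLast? = some e →
    ∀ g : LocallyConstant (PathSpace G) ℂ,
      z ^ a.edges.length * ν (toIsland G x (shiftCylinder a.edges g)) =
        z ^ b.edges.length * ν (toIsland G x (shiftCylinder b.edges g))

/-- Paths through `a` correspond to paths through `b` with the same tail, and there the density is
`z ^ (|a| - |b|)`, which trades one weight for the other. -/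
theorem shiftCylinder_aut {z : ℂ} (hz : z ≠ 0) {γ : universalCover G x ≃g universalCover G x}
    (hγ : γ ∈ deckGroup G x) {a b : CoverVertex G x} {e : G.Dart} (hab : γ a = b)
    (ha : a.edges.getLast? = some e) (hb : b.edges.getLast? = some e)
    (g : LocallyConstant (PathSpace G) ℂ) (p : Island G x) :
    z ^ b.edges.length *
      (z ^ horoDist (universalCover_isTree G x) (Boundary.aut _ γ (islandHomeo G x p))
          (γ (coverBase G x)) (coverBase G x) *
        toIsland G x (shiftCylinder b.edges g)
          ((islandHomeo G x).symm (Boundary.aut _ γ (islandHomeo G x p)))) =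
      z ^ a.edges.length * toIsland G x (shiftCylinder a.edges g) p := by
  by_cases hp : p.1.take a.edges.length = a.edges
  · obtain ⟨q, hq, hpq⟩ := exists_island_shift ha hb hp
    have h0 : γ (pathPrefix p a.edges.length) = pathPrefix q b.edges.length := by
      rw [pathPrefix_eq_iff.2 hp, pathPrefix_eq_iff.2 hq, hab]
    rw [horoDist_aut_islandHomeo hγ h0 hpq, aut_islandHomeo hγ h0 hpq,
      Homeomorph.symm_apply_apply, toIsland_apply, toIsland_apply, shiftCylinder_of_take hp,
      shiftCylinder_of_take hq, ← mul_assoc, zpow_sub₀ hz, zpow_natCast, zpow_natCast,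
      mul_div_cancel₀ _ (pow_ne_zero _ hz)]
    congr 2
    refine PathSpace.ext (funext fun k => ?_)
    obtain ⟨c, hc⟩ := exists_edges_eq ha
    obtain ⟨d, hd⟩ := exists_edges_eq hb
    have hc' : a.edges.length = c.edges.length + 1 := by simp [hc]
    have hd' : b.edges.length = d.edges.length + 1 := by simp [hd]
    rw [PathSpace.drop_apply, PathSpace.drop_apply]
    -- `hpq` compares the tails behind `a` and `b`; at position zero stands the common last edge
    -- `e`.
    cases k with
    | zero =>
      rw [hc', PathSpace.take_succ, hc] at hp
      rw [hd', PathSpace.take_succ, hd] at hq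
      have hp' : p.1 c.edges.length = e := by simpa using (List.append_inj' hp rfl).2
      have hq' : q.1 d.edges.length = e := by simpa using (List.append_inj' hq rfl).2
      rw [hc', hd', Nat.add_sub_cancel, Nat.add_sub_cancel, add_zero, add_zero, hp', hq']
    | succ k =>
      have := hpq k
      rw [show a.edges.length - 1 + (k + 1) = a.edges.length + k by omega,
        show b.edges.length - 1 + (k + 1) = b.edges.length + k by omega, this]
  · rw [toIsland_apply _ p, shiftCylinder_of_not hp, toIsland_apply, shiftCylinder_of_not,
      mul_zero, mul_zero, mul_zero]
    -- If the image of `p` ran through `b`, applying the inverse of `γ` would show that `p` runs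
    -- through `a`.
    intro hq
    apply hp
    set q := (islandHomeo G x).symm (Boundary.aut _ γ (islandHomeo G x p)) with hqdef
    obtain ⟨p', hp', hpq⟩ := exists_island_shift hb ha hq
    have h0 : γ⁻¹ (pathPrefix q b.edges.length) = pathPrefix p' a.edges.length := by
      rw [pathPrefix_eq_iff.2 hp', pathPrefix_eq_iff.2 hq, ← hab]
      exact RelIso.inv_apply_self γ a
    have h1 := aut_islandHomeo (inv_mem hγ) h0 hpq
    rw [hqdef, Homeomorph.apply_symm_apply, aut_inv_aut] at h1
    rw [(islandHomeo G x).injective h1]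
    exact hp'

theorem twistedAction_shiftCylinder {z : ℂ} (hz : z ≠ 0)
    {γ : universalCover G x ≃g universalCover G x}
    (hγ : γ ∈ deckGroup G x) {a b : CoverVertex G x} {e : G.Dart} (hab : γ a = b)
    (ha : a.edges.getLast? = some e) (hb : b.edges.getLast? = some e)
    (g : LocallyConstant (PathSpace G) ℂ) (ν : FinAddMeasure (Island G x)) :
    z ^ b.edges.length * twistedAction (universalCover_isTree G x) (coverBase G x) z γ
        (FinAddMeasure.map islandToBoundary ν)
        (toBoundary G x (toIsland G x (shiftCylinder b.edges g))) =
      z ^ a.edges.length * ν (toIsland G x (shiftCylinder a.edges g)) := by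
  rw [← smul_eq_mul, ← smul_eq_mul, ← map_smul ν]
  refine (map_smul ν (z ^ b.edges.length) _).symm.trans (congrArg ν ?_)
  ext p
  exact shiftCylinder_aut hz hγ hab ha hb g p

variable [Fintype V] [DecidableEq V] [DecidableRel G.Adj]

/-- A measure on an island is determined by its values on functions with small support. -/
theorem measure_ext_of_length {φ ψ : FinAddMeasure (Island G x)} (N : ℕ)
    (h : ∀ (b : CoverVertex G x) (g : LocallyConstant (PathSpace G) ℂ), N < b.edges.length →
      φ (toIsland G x (shiftCylinder b.edges g)) = ψ (toIsland G x (shiftCylinder b.edges g))) :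
    φ = ψ := by
  induction N with
  | zero =>
    refine LinearMap.ext fun f => ?_
    rw [← toIsland_extendByZero f, ← sum_shiftCylinder_singleton (extendByZero G x f)]
    simp only [map_sum]
    refine Finset.sum_congr rfl fun e _ => ?_
    by_cases he : e.fst = x
    · exact h ⟨[e], by simp, by simpa using he⟩ _ (by simp)
    · have : toIsland G x (shiftCylinder [e] (extendByZero G x f)) = 0 := by
        ext p
        refine shiftCylinder_singleton_of_ne e p.1 (fun hp => he ?_) _
        rw [← hp]
        exact p.2
      rw [this, map_zero, map_zero]
  | succ N ih =>
    -- Cutting the cylinder of `b` by its next edge gives cylinders longer by one, to which the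
    -- hypothesis applies; the pieces that are not paths vanish.
    refine ih fun b g hb => ?_
    obtain ⟨d, hd⟩ := exists_getLast (d := b) (by rintro h; simp [h] at hb)
    obtain ⟨c, hc⟩ := exists_edges_eq hd
    rw [hc, shiftCylinder_eq_sum, ← hc]
    simp only [map_sum]
    refine Finset.sum_congr rfl fun e _ => ?_
    by_cases ht : Turn d e
    · obtain ⟨b', hb'⟩ := exists_snoc b e (by rw [coverProj, hd]; exact ht.1.symm)
        (by rw [hd]; exact fun h => ht.2 (Option.some.inj h))
      rw [← hb']
      exact h b' _ (by rw [hb', List.length_append, List.length_singleton]; omega)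
    · rw [shiftCylinder_extendBy_of_not ht, map_zero, map_zero, map_zero]

/-- The measures on the boundary that are invariant under the twisted action of the fundamental
group correspond to the conformal measures on the island of the base vertex. -/
theorem map_mem_twistedInvariants_iff {z : ℂ} (hz : z ≠ 0) (ν : FinAddMeasure (Island G x)) :
    FinAddMeasure.map islandToBoundary ν ∈ twistedInvariants (universalCover_isTree G x)
      (coverBase G x) z (deckGroup G x) ↔ IsConformal z ν := by
  constructor
  · intro h a b e ha hb g
    obtain ⟨γ, hγ, hab⟩ := exists_deck a b (by rw [coverProj, coverProj, ha, hb])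
    rw [← twistedAction_shiftCylinder hz hγ hab ha hb g ν, h γ hγ, map_islandToBoundary_apply]
  · intro h γ hγ
    set φ := twistedAction (universalCover_isTree G x) (coverBase G x) z γ
      (FinAddMeasure.map islandToBoundary ν) with hφ
    have key : φ ∘ₗ toBoundary G x = ν := by
      -- Beyond this length `γ⁻¹` preserves last edges, by `deck_getLast`, so conformality compares
      -- `γ⁻¹ b` with `b`.
      refine measure_ext_of_length (γ⁻¹ (coverBase G x)).edges.length fun b g hb => ?_
      have hlast := deck_getLast (inv_mem hγ) b hb
      obtain ⟨e, he⟩ := exists_getLast (d := b) (by rintro h; simp [h] at hb)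
      rw [he] at hlast
      have h1 := twistedAction_shiftCylinder hz hγ (RelIso.apply_inv_self γ b) hlast he g ν
      rw [h _ _ e hlast he] at h1
      exact mul_left_cancel₀ (pow_ne_zero _ hz) h1
    refine LinearMap.ext fun f => ?_
    rw [← toBoundary_comap f, map_islandToBoundary_apply]
    exact LinearMap.congr_fun key _

end Boundary

/-! ### Eigenmeasures and conformal measures -/

section Eigenmeasures

variable {V : Type u} {G : SimpleGraph V} {x : V}

theorem extendByZero_of_ne {p : PathSpace G} (h : p.start ≠ x)
    (f : LocallyConstant (Island G x) ℂ) : extendByZero G x f p = 0 :=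
  dif_neg h

theorem extendByZero_toIsland {a : CoverVertex G x} (ha : a.edges ≠ [])
    (g : LocallyConstant (PathSpace G) ℂ) :
    extendByZero G x (toIsland G x (shiftCylinder a.edges g)) = shiftCylinder a.edges g := by
  ext p
  by_cases h : p.start = x
  · exact dif_pos h
  · rw [extendByZero_of_ne h, shiftCylinder_of_not]
    exact fun hp => h (PathSpace.start_eq_of_take ha a.head hp)

theorem shiftCylinder_extendByZero_of_ne {l : List G.Dart} {e : G.Dart} (h : e.fst ≠ x)
    (f : LocallyConstant (Island G x) ℂ) :
    shiftCylinder (l ++ [e]) (extendByZero G x f) = 0 := by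
  ext p
  by_cases hp : p.take (l ++ [e]).length = l ++ [e]
  · rw [shiftCylinder_of_take hp]
    refine extendByZero_of_ne (fun hx => h ?_) f
    rw [List.length_append, List.length_singleton, PathSpace.take_succ] at hp
    have he : p l.length = e := by simpa using (List.append_inj' hp rfl).2
    rw [← he, ← hx]
    simp [PathSpace.start]
  · exact shiftCylinder_of_not hp _

variable [Fintype V] [DecidableEq V] [DecidableRel G.Adj]

/-- Each edge of `l` is removed by one application of the transfer operator, at the cost of one
factor `z`. -/
theorem eigenmeasure_shiftCylinder {z : ℂ} {μ : FinAddMeasure (PathSpace G)}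
    (hμ : dualTransfer G μ = z • μ) {l : List G.Dart} {e : G.Dart}
    (hl : (l ++ [e]).IsChain Turn) (g : LocallyConstant (PathSpace G) ℂ) :
    z ^ l.length * μ (shiftCylinder (l ++ [e]) g) = μ (shiftCylinder [e] g) := by
  induction l with
  | nil => simp
  | cons d l ih =>
    obtain ⟨f, l', hf⟩ : ∃ f l', l ++ [e] = f :: l' :=
      List.exists_cons_of_ne_nil (by simp)
    rw [List.cons_append] at hl ⊢
    rw [← ih hl.tail, hf, List.length_cons, pow_succ, mul_assoc]
    rw [hf] at hl
    rw [← transfer_shiftCylinder (List.isChain_cons_cons.1 hl).1 g]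
    exact congrArg _ (LinearMap.congr_fun hμ _).symm

theorem isConformal_restrictIsland {z : ℂ} {μ : FinAddMeasure (PathSpace G)}
    (hμ : dualTransfer G μ = z • μ) : IsConformal z (restrictIsland G x μ) := by
  have key : ∀ (a : CoverVertex G x) (e : G.Dart), a.edges.getLast? = some e →
      ∀ g : LocallyConstant (PathSpace G) ℂ, z ^ a.edges.length *
        restrictIsland G x μ (toIsland G x (shiftCylinder a.edges g)) =
          z * μ (shiftCylinder [e] g) := by
    intro a e ha g
    have hne : a.edges ≠ [] := by
      rintro h
      simp [h] at ha
    have h1 : restrictIsland G x μ (toIsland G x (shiftCylinder a.edges g)) =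
        μ (shiftCylinder a.edges g) := congrArg μ (extendByZero_toIsland hne g)
    obtain ⟨c, hc⟩ := exists_edges_eq ha
    have hchain := a.chain
    rw [h1]
    rw [hc] at hchain ⊢
    rw [← eigenmeasure_shiftCylinder hμ hchain g, List.length_append, List.length_singleton,
      pow_succ', mul_assoc]
  intro a b e ha hb g
  rw [key a e ha, key b e hb]

/-- The part of `μ` on paths starting with `e` is a power of `z` times its value on the cylinder of
a path from `x` ending in `e`, and that cylinder lies in the island. -/
theorem eigenmeasure_eq_zero (hconn : G.Connected) (hdeg : ∀ v, 2 ≤ G.degree v) {z : ℂ}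
    {μ : FinAddMeasure (PathSpace G)} (hμ : dualTransfer G μ = z • μ)
    (h : restrictIsland G x μ = 0) : μ = 0 := by
  refine LinearMap.ext fun g => ?_
  rw [← sum_shiftCylinder_singleton g, map_sum]
  refine Finset.sum_eq_zero fun e _ => ?_
  obtain ⟨a, ha⟩ := exists_coverVertex_getLast (x := x) hconn hdeg e
  obtain ⟨c, hc⟩ := exists_edges_eq ha
  have hchain := a.chain
  rw [hc] at hchain
  rw [← eigenmeasure_shiftCylinder hμ hchain g, ← hc, ← extendByZero_toIsland (by simp [hc]) g]
  have h1 : μ (extendByZero G x (toIsland G x (shiftCylinder a.edges g))) = 0 :=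
    LinearMap.congr_fun h _
  rw [h1, mul_zero]

theorem exists_eigenmeasure (hconn : G.Connected) (hdeg : ∀ v, 2 ≤ G.degree v) {z : ℂ}
    (hz : z ≠ 0) {ν : FinAddMeasure (Island G x)} (hν : IsConformal z ν) :
    ∃ μ : FinAddMeasure (PathSpace G), dualTransfer G μ = z • μ ∧ restrictIsland G x μ = ν := by
  choose c hc using fun e : G.Dart => exists_coverVertex_getLast (x := x) hconn hdeg e
  choose c' hc' using fun e : G.Dart => exists_edges_eq (hc e)
  -- The formula is forced by `eigenmeasure_shiftCylinder`. The factor `z⁻¹` appears because only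
  -- the edges before `e` count there, one fewer than the length of `c e`.
  let μ : FinAddMeasure (PathSpace G) := z⁻¹ • ∑ e : G.Dart,
    z ^ (c e).edges.length • (ν ∘ₗ toIsland G x ∘ₗ shiftCylinder (c e).edges)
  have hμ : ∀ f, μ f = z⁻¹ * ∑ e : G.Dart,
      z ^ (c e).edges.length * ν (toIsland G x (shiftCylinder (c e).edges f)) := by
    intro f
    simp [μ, LinearMap.sum_apply]
  refine ⟨μ, LinearMap.ext fun f => ?_, LinearMap.ext fun f => ?_⟩
  · change μ (transfer G f) = z * μ f
    rw [hμ, hμ, mul_left_comm]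
    congr 1
    have h1 : ∀ e : G.Dart,
        z ^ (c e).edges.length * ν (toIsland G x (shiftCylinder (c e).edges (transfer G f))) =
        ∑ d : G.Dart, z ^ (c e).edges.length *
          ν (toIsland G x (shiftCylinder (c e).edges (extendBy d f))) := by
      intro e
      rw [transfer_eq_sum, ← Finset.mul_sum]
      simp only [map_sum]
    have h2 : ∀ d : G.Dart,
        z * (z ^ (c d).edges.length * ν (toIsland G x (shiftCylinder (c d).edges f))) =
        ∑ e : G.Dart, z ^ ((c d).edges.length + 1) *
          ν (toIsland G x (shiftCylinder ((c d).edges ++ [e]) (extendBy d f))) := by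
      intro d
      conv_lhs => rw [hc' d, shiftCylinder_eq_sum, ← hc' d]
      rw [← Finset.mul_sum, pow_succ', mul_assoc]
      simp only [map_sum]
    rw [Finset.mul_sum]
    simp only [h1, h2]
    rw [Finset.sum_comm]
    -- For a turn from `d` to `e`, both `c e` and `c d` prolonged by `e` end in `e`, so conformality
    -- equates the two terms.
    refine Finset.sum_congr rfl fun d _ => Finset.sum_congr rfl fun e _ => ?_
    by_cases ht : Turn d e
    · obtain ⟨b, hb⟩ := exists_snoc (c d) e (by rw [coverProj, hc]; exact ht.1.symm)
        (by rw [hc]; exact fun h => ht.2 (Option.some.inj h))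
      have hlen : b.edges.length = (c d).edges.length + 1 := by simp [hb]
      rw [← hb, ← hlen]
      exact hν (c e) b e (hc e) (by simp [hb]) _
    · rw [hc' e, shiftCylinder_extendBy_of_not ht, shiftCylinder_extendBy_of_not ht, map_zero,
        map_zero, mul_zero, mul_zero]
  · change μ (extendByZero G x f) = ν f
    conv_rhs => rw [← toIsland_extendByZero f,
      ← sum_shiftCylinder_singleton (extendByZero G x f)]
    rw [hμ, Finset.mul_sum]
    simp only [map_sum]
    refine Finset.sum_congr rfl fun e _ => ?_
    -- If `e` issues from `x`, the path `[e]` of length one is comparable with `c e`, and its weight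
    -- `z` cancels `z⁻¹`.
    by_cases he : e.fst = x
    · have h1 := hν (c e) ⟨[e], by simp, by simpa using he⟩ e (hc e) (by simp)
        (extendByZero G x f)
      rw [h1]
      simp [hz]
    · have h1 := shiftCylinder_extendByZero_of_ne (l := []) he f
      rw [List.nil_append] at h1
      rw [hc' e, shiftCylinder_extendByZero_of_ne he, h1, map_zero, map_zero, mul_zero, mul_zero]

end Eigenmeasures

end PathGraph

end

/-! ### The isomorphism -/

theorem mainTheorem8 {V : Type*} [Fintype V] [DecidableEq V] (G : SimpleGraph V)
    [DecidableRel G.Adj] (hconn : G.Connected) (hdeg : ∀ v, 2 ≤ G.degree v) (x : V)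
    (z : ℂ) (hz : z ≠ 0) :
    ∃ Φ : Module.End.eigenspace (PathGraph.dualTransfer G) z ≃ₗ[ℂ]
        PathGraph.twistedInvariants (PathGraph.universalCover_isTree G x)
          (PathGraph.coverBase G x) z (PathGraph.deckGroup G x),
      ∀ μ, (Φ μ : PathGraph.FinAddMeasure (PathGraph.CoverBoundary G x)) =
        PathGraph.restriction G x μ := by
  have hmem : ∀ μ : Module.End.eigenspace (PathGraph.dualTransfer G) z,
      PathGraph.restriction G x μ ∈ PathGraph.twistedInvariants
        (PathGraph.universalCover_isTree G x) (PathGraph.coverBase G x) z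
        (PathGraph.deckGroup G x) := fun μ =>
    (PathGraph.map_mem_twistedInvariants_iff hz _).2
      (PathGraph.isConformal_restrictIsland (Module.End.mem_eigenspace_iff.1 μ.2))
  refine ⟨LinearEquiv.ofBijective
    (((PathGraph.restriction G x).domRestrict _).codRestrict _ hmem) ⟨?_, ?_⟩, fun μ => rfl⟩
  · rw [← LinearMap.ker_eq_bot, LinearMap.ker_eq_bot']
    intro μ hμ
    have h1 : PathGraph.restriction G x μ = 0 := congrArg Subtype.val hμ
    refine Subtype.ext (PathGraph.eigenmeasure_eq_zero (x := x) hconn hdeg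
      (Module.End.mem_eigenspace_iff.1 μ.2) (LinearMap.ext fun f => ?_))
    rw [← PathGraph.map_islandToBoundary_apply]
    exact LinearMap.congr_fun h1 _
  · rintro ⟨ρ, hρ⟩
    -- The homeomorphism of island and boundary makes every boundary measure the image of one on the
    -- island.
    obtain ⟨ν, rfl⟩ : ∃ ν, PathGraph.FinAddMeasure.map PathGraph.islandToBoundary ν = ρ := by
      refine ⟨ρ ∘ₗ PathGraph.toBoundary G x, LinearMap.ext fun f => ?_⟩
      exact congrArg ρ (PathGraph.toBoundary_comap f)
    obtain ⟨μ, hμ, rfl⟩ := PathGraph.exists_eigenmeasure hconn hdeg hz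
      ((PathGraph.map_mem_twistedInvariants_iff hz ν).1 hρ)
    exact ⟨⟨μ, Module.End.mem_eigenspace_iff.2 hμ⟩, rfl⟩
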